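/- Theorem 1.2. Let $\triangle_H=\{(z,w)\in\mathbb C^2: |z|<|w|<1\}$ be the Hartogs triangle and let $H^2(\triangle_H)$ be the Hilbert space of all holomorphic functions $f$ on $\triangle_H$ with $$\|f\|^2=\sup_{0<s,t<1}\frac1{4\pi^2}\int_0^{2\pi}\!\!\int_0^{2\pi}\bigl|f(st\,e^{i\theta},t\,e^{i\gamma})\bigr|^2\,st^2\,d\theta\,d\gamma<\infty .$$ Let $M_z,M_w$ be multiplication by the coordinate functions on $H^2(\triangle_H)$. A quotient module is a closed subspace $\mathcal Q\subseteq H^2(\triangle_H)$ with $M_z^*\mathcal Q\subseteq\mathcal Q$ and $M_w^*\mathcal Q\subseteq\mathcal Q$; with $Q_z=P_{\mathcal Q}M_z|_{\mathcal Q}$ and $Q_w=P_{\mathcal Q}M_w|_{\mathcal Q}$, it is called doubly commuting if $Q_z^*Q_w=Q_wQ_z^*$. Let $\theta_1,\theta_2$ be inner functions on the open unit disc $\mathbb D$, i.e. holomorphic functions with $|\theta_k|\le 1$ on $\mathbb D$ whose radial limits have modulus one almost everywhere on the unit circle $\mathbb T$. Then the quotient module $$H^2(\triangle_H)\ominus \theta_1(z/w)\,\theta_2(w)\,H^2(\triangle_H)$$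 is doubly commuting if and only if one of the following holds: (i) $\theta_1$ and $\theta_2$ are constant; (ii) $\theta_1$ is constant and $\theta_2(w)=c\,\dfrac{w-b}{1-\bar b w}$ for some $b\in\mathbb D$ and $c\in\mathbb T$; (iii) $\theta_2$ is constant and $\theta_1(z)=c_1z$ for some $c_1\in\mathbb T$; (iv) $\theta_1(z)=c_1z$ and $\theta_2(w)=c_2w$ for some $c_1,c_2\in\mathbb T$. -/

import Mathlib

noncomputable section

namespace Hartogs

open Complex MeasureTheory Set Filter Topology

/-- The Hartogs triangle `{(z, w) : |z| < |w| < 1}`. -/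
def hartogsTriangle : Set (ℂ × ℂ) := {p | ‖p.1‖ < ‖p.2‖ ∧ ‖p.2‖ < 1}

/-- The weighted mean `(4π²)⁻¹ ∫∫ |f(s t e^{iθ}, t e^{iγ})|² s t² dθ dγ`. -/
def hardyMean (f : ℂ × ℂ → ℂ) (s t : ℝ) : ℝ :=
  1 / (4 * Real.pi ^ 2) * ∫ θ in (0 : ℝ)..(2 * Real.pi), ∫ γ in (0 : ℝ)..(2 * Real.pi),
    ‖f (s * t * exp (θ * I), t * exp (γ * I))‖ ^ 2 * (s * t ^ 2)

theorem isOpen_hartogsTriangle : IsOpen hartogsTriangle :=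
  (isOpen_lt continuous_fst.norm continuous_snd.norm).inter
    (isOpen_lt continuous_snd.norm continuous_const)

theorem mem_hartogsTriangle_polar {r t : ℝ} (hr : 0 ≤ r) (hrt : r < t) (ht : t < 1) (a b : ℝ) :
    ((r : ℂ) * exp (a * I), (t : ℂ) * exp (b * I)) ∈ hartogsTriangle := by
  have ht0 : 0 < t := hr.trans_lt hrt
  simp [hartogsTriangle, norm_exp_ofReal_mul_I, abs_of_nonneg hr, abs_of_pos ht0, hrt, ht]

theorem continuous_polar {f : ℂ × ℂ → ℂ} (hf : ContinuousOn f hartogsTriangle) {r t : ℝ}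
    (hr : 0 ≤ r) (hrt : r < t) (ht : t < 1) :
    Continuous fun x : ℝ × ℝ => f ((r : ℂ) * exp (x.1 * I), (t : ℂ) * exp (x.2 * I)) :=
  hf.comp_continuous (by fun_prop) fun x => mem_hartogsTriangle_polar hr hrt ht x.1 x.2

theorem continuous_polar_torus {f : ℂ × ℂ → ℂ} (hf : ContinuousOn f hartogsTriangle) {r t : ℝ}
    (hr : 0 ≤ r) (hrt : r < t) (ht : t < 1) :
    Continuous fun x : UnitAddTorus (Fin 2) =>
      f ((r : ℂ) * fourier 1 (x 0), (t : ℂ) * fourier 1 (x 1)) := by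
  refine hf.comp_continuous (by fun_prop) fun x => ?_
  have ht0 : 0 < t := hr.trans_lt hrt
  have h1 : ∀ y : UnitAddCircle, ‖fourier 1 y‖ = 1 := fun y => by
    rw [fourier_apply]; exact Circle.norm_coe _
  simp only [hartogsTriangle, mem_ofPred_eq, norm_mul, h1, norm_real, Real.norm_eq_abs,
    abs_of_nonneg hr, abs_of_pos ht0, mul_one]
  exact ⟨hrt, ht⟩

theorem cube_integral {E : Type*} [NormedAddCommGroup E] [NormedSpace ℝ E] 
    (H : ℝ → ℝ → E) (hH : Continuous (Function.uncurry H)) :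
    ∫ x in {x : Fin 2 → ℝ | ∀ i, x i ∈ Ioc ((0 : Fin 2 → ℝ) i) ((0 : Fin 2 → ℝ) i + 1)},
      H (2 * Real.pi * x 0) (2 * Real.pi * x 1) =
    (1 / (4 * Real.pi ^ 2)) • ∫ a in (0 : ℝ)..(2 * Real.pi), ∫ b in (0 : ℝ)..(2 * Real.pi), H a b := by
  have e := (volume_preserving_finTwoArrow ℝ).setIntegral_preimage_emb
    (MeasurableEquiv.finTwoArrow (α := ℝ)).measurableEmbedding
    (fun p : ℝ × ℝ => H (2 * Real.pi * p.1) (2 * Real.pi * p.2)) (Ioc 0 1 ×ˢ Ioc 0 1)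
  have hset : (MeasurableEquiv.finTwoArrow (α := ℝ)) ⁻¹' (Ioc 0 1 ×ˢ Ioc 0 1) =
      {x : Fin 2 → ℝ | ∀ i, x i ∈ Ioc ((0 : Fin 2 → ℝ) i) ((0 : Fin 2 → ℝ) i + 1)} := by
    ext x
    simp [MeasurableEquiv.finTwoArrow, Fin.forall_fin_two]
  rw [hset] at e
  have hpi : (2 * Real.pi) ≠ 0 := by positivity
  refine e.trans ?_
  have hc : Continuous fun p : ℝ × ℝ => H (2 * Real.pi * p.1) (2 * Real.pi * p.2) :=
    hH.comp (by fun_prop : Continuous fun p : ℝ × ℝ => (2 * Real.pi * p.1, 2 * Real.pi * p.2))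
  rw [Measure.volume_eq_prod, setIntegral_prod _ ((hc.continuousOn.integrableOn_compact
    (isCompact_Icc.prod isCompact_Icc)).mono_set
      (prod_mono Ioc_subset_Icc_self Ioc_subset_Icc_self))]
  simp only [← intervalIntegral.integral_of_le zero_le_one]
  have h1 : ∀ x : ℝ, ∫ y in (0 : ℝ)..1, H (2 * Real.pi * x) (2 * Real.pi * y) =
      (2 * Real.pi)⁻¹ • ∫ b in (0 : ℝ)..(2 * Real.pi), H (2 * Real.pi * x) b := fun x => by
    rw [intervalIntegral.integral_comp_mul_left (fun b => H (2 * Real.pi * x) b) hpi]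
    simp
  simp only [h1]
  rw [intervalIntegral.integral_comp_mul_left
    (fun a => (2 * Real.pi)⁻¹ • ∫ b in (0 : ℝ)..(2 * Real.pi), H a b) hpi,
    intervalIntegral.integral_smul, smul_smul]
  simp only [mul_zero, mul_one]
  congr 1
  field_simp
  ring

/-- The function `(x₀, x₁) ↦ f (r e(x₀), t e(x₁))` on the torus. -/
def polarMap (f : ℂ × ℂ → ℂ) (hf : ContinuousOn f hartogsTriangle) (r t : ℝ)
    (hr : 0 ≤ r) (hrt : r < t) (ht : t < 1) : C(UnitAddTorus (Fin 2), ℂ) :=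
  ⟨_, continuous_polar_torus hf hr hrt ht⟩

/-- The Laurent coefficient of `z ^ m * w ^ n`, computed on the torus of radii `r`, `t`. -/
def laurentCoeff (f : ℂ × ℂ → ℂ) (r t : ℝ) (m n : ℤ) : ℂ :=
  (1 / (4 * Real.pi ^ 2) : ℝ) • ∫ a in (0 : ℝ)..(2 * Real.pi), ∫ b in (0 : ℝ)..(2 * Real.pi),
    ((r : ℂ) * exp (a * I)) ^ (-m) * ((t : ℂ) * exp (b * I)) ^ (-n) *
      f ((r : ℂ) * exp (a * I), (t : ℂ) * exp (b * I))

theorem fourier_two_pi (x : ℝ) (n : ℤ) :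
    fourier n (x : UnitAddCircle) = exp ((2 * Real.pi * x : ℝ) * I) ^ n := by
  rw [fourier_coe_apply, ← Complex.exp_int_mul]
  congr 1
  push_cast
  ring

theorem mFourierCoeff_polarMap {f : ℂ × ℂ → ℂ} (hf : ContinuousOn f hartogsTriangle) {r t : ℝ}
    (hr : 0 < r) (hrt : r < t) (ht : t < 1) (n : Fin 2 → ℤ) :
    UnitAddTorus.mFourierCoeff (polarMap f hf r t hr.le hrt ht) n =
      (r : ℂ) ^ n 0 * (t : ℂ) ^ n 1 * laurentCoeff f r t (n 0) (n 1) := by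
  have ht0 : 0 < t := hr.trans hrt
  have hrc : (r : ℂ) ≠ 0 := by exact_mod_cast hr.ne'
  have htc : (t : ℂ) ≠ 0 := by exact_mod_cast ht0.ne'
  rw [UnitAddTorus.mFourierCoeff_eq_integral _ _ 0]
  have hc := continuous_polar hf hr.le hrt ht
  have := cube_integral (fun a b : ℝ => (r : ℂ) ^ n 0 * (t : ℂ) ^ n 1 * (((r : ℂ) * exp (a * I)) ^ (-n 0) *
    ((t : ℂ) * exp (b * I)) ^ (-n 1) * f ((r : ℂ) * exp (a * I), (t : ℂ) * exp (b * I)))) (by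
      refine Continuous.mul (by fun_prop) (Continuous.mul (Continuous.mul ?_ ?_) hc)
      · exact Continuous.zpow₀ (by fun_prop) _ (fun x => Or.inl (by simp [hrc]))
      · exact Continuous.zpow₀ (by fun_prop) _ (fun x => Or.inl (by simp [htc])))
  simp only [intervalIntegral.integral_const_mul] at this
  rw [laurentCoeff, mul_smul_comm, ← this]
  congr 1
  ext x
  have e1 := fourier_two_pi (x 0)
  have e2 := fourier_two_pi (x 1)
  simp only [UnitAddTorus.mFourier, polarMap, ContinuousMap.coe_mk, Fin.prod_univ_two, e1, e2, Pi.neg_apply, smul_eq_mul, mul_zpow, zpow_one, zpow_neg]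
  field_simp

theorem hasSum_hardyMean {f : ℂ × ℂ → ℂ} (hf : ContinuousOn f hartogsTriangle) {s t : ℝ}
    (hs : s ∈ Ioo (0 : ℝ) 1) (ht : t ∈ Ioo (0 : ℝ) 1) :
    HasSum (fun n : Fin 2 → ℤ => ‖laurentCoeff f (s * t) t (n 0) (n 1)‖ ^ 2 *
      (s ^ (2 * n 0 + 1) * t ^ (2 * (n 0 + n 1 + 1)))) (hardyMean f s t) := by
  have hr : 0 < s * t := mul_pos hs.1 ht.1
  have hrt : s * t < t := by nlinarith [hs.1, hs.2, ht.1]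
  have h := UnitAddTorus.hasSum_sq_mFourierCoeff
    (ContinuousMap.toLp (E := ℂ) 2 (Measure.pi fun _ : Fin 2 => AddCircle.haarAddCircle (T := 1)) ℂ
      (polarMap f hf (s * t) t hr.le hrt ht.2))
  replace h := h.congr_fun (fun n => (congrArg (fun c => ‖c‖ ^ 2) ((UnitAddTorus.mFourierCoeff_toLp _ n).trans
    (mFourierCoeff_polarMap hf hr hrt ht.2 n))).symm)
  have e : hardyMean f s t = s * t ^ 2 * ∫ x, ‖(polarMap f hf (s * t) t hr.le hrt ht.2) x‖ ^ 2
      ∂(Measure.pi fun _ : Fin 2 => AddCircle.haarAddCircle (T := 1)) := by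
    have hc := continuous_polar hf hr.le hrt ht.2
    have := cube_integral (fun a b : ℝ =>
      ‖f (((s * t : ℝ) : ℂ) * exp (a * I), (t : ℂ) * exp (b * I))‖ ^ 2) ((continuous_pow 2).comp hc.norm)
    have h2 := UnitAddTorus.integral_preimage
      (fun x => ‖(polarMap f hf (s * t) t hr.le hrt ht.2) x‖ ^ 2) 0
    have h3 : ∀ x : Fin 2 → ℝ, ‖(polarMap f hf (s * t) t hr.le hrt ht.2) (fun i => (x i : UnitAddCircle))‖ ^ 2 =
       ‖f (((s * t : ℝ) : ℂ) * exp ((2 * Real.pi * x 0 : ℝ) * I), (t : ℂ) * exp ((2 * Real.pi * x 1 : ℝ) * I))‖ ^ 2 := fun x => by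
      simp only [polarMap, ContinuousMap.coe_mk, fourier_two_pi, zpow_one]
    simp only [h3] at h2
    refine Eq.trans ?_ (congrArg _ (h2.trans this).symm)
    simp only [hardyMean, intervalIntegral.integral_mul_const, smul_eq_mul]
    push_cast
    ring
  have h4 : ∫ x, ‖(polarMap f hf (s * t) t hr.le hrt ht.2) x‖ ^ 2
      ∂(Measure.pi fun _ : Fin 2 => AddCircle.haarAddCircle (T := 1)) = ∫ x, ‖(ContinuousMap.toLp (E := ℂ) 2 (Measure.pi fun _ : Fin 2 => AddCircle.haarAddCircle (T := 1)) ℂ (polarMap f hf (s * t) t hr.le hrt ht.2)) x‖ ^ 2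
      ∂(Measure.pi fun _ : Fin 2 => AddCircle.haarAddCircle (T := 1)) := by
    refine integral_congr_ae ?_
    filter_upwards [ContinuousMap.coeFn_toLp (p := 2) (𝕜 := ℂ) (Measure.pi fun _ : Fin 2 => AddCircle.haarAddCircle (T := 1)) (polarMap f hf (s * t) t hr.le hrt ht.2)] with x hx
    rw [hx]
  rw [e, h4]
  refine (h.mul_left (s * t ^ 2)).congr_fun fun n => ?_
  have hs0 := hs.1.ne'
  have ht0 := ht.1.ne'
  rw [norm_mul, norm_mul, norm_zpow, norm_zpow, norm_real, norm_real, Real.norm_of_nonneg hr.le,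
    Real.norm_of_nonneg ht.1.le, zpow_add₀ hs0, zpow_mul, zpow_mul, zpow_add₀ (by positivity), zpow_add₀ (by positivity)]
  simp only [mul_zpow, zpow_one, ← zpow_natCast, ← zpow_mul, mul_comm (2 : ℤ)]
  push_cast
  ring

theorem circle_integral_eq_of_annulus {g : ℂ → ℂ} {U : Set ℂ} (hU : IsOpen U)
    (hg : DifferentiableOn ℂ g U) {r R : ℝ} (hr : 0 < r) (hrR : r ≤ R)
    (hsub : ∀ z : ℂ, r ≤ ‖z‖ → ‖z‖ ≤ R → z ∈ U) :
    ∫ a in (0 : ℝ)..(2 * Real.pi), g ((R : ℂ) * exp (a * I)) =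
      ∫ a in (0 : ℝ)..(2 * Real.pi), g ((r : ℂ) * exp (a * I)) := by
  have h := circleIntegral_sub_center_inv_smul_eq_of_differentiable_on_annulus_off_countable
    (c := 0) (f := g) hr hrR countable_empty
    (hg.continuousOn.mono fun z hz => hsub z (by simpa using hz.2) (by simpa using hz.1))
    (fun z hz => hg.differentiableAt (hU.mem_nhds (hsub z
      (by have := hz.1.2; simp at this; exact this.le) (by have := hz.1.1; simp at this; exact this.le))))
  have h1 := Real.circleAverage_eq_circleIntegral (f := g) (c := 0) (R := R) (hr.trans_le hrR).ne'
  have h2 := Real.circleAverage_eq_circleIntegral (f := g) (c := 0) (R := r) hr.ne'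
  rw [h, ← h2, Real.circleAverage_def, Real.circleAverage_def] at h1
  have h3 : (2 * Real.pi)⁻¹ ≠ 0 := by positivity
  simpa [circleMap] using (smul_right_injective ℂ h3 h1)

theorem laurentCoeff_eq_of_radius {f : ℂ × ℂ → ℂ} (hf : DifferentiableOn ℂ f hartogsTriangle)
    {r t r' t' : ℝ} (hr : 0 < r) (hrt : r < t) (ht : t < 1) (hr' : 0 < r') (hrt' : r' < t')
    (ht' : t' < 1) (m n : ℤ) : laurentCoeff f r t m n = laurentCoeff f r' t' m n := by
  have A : ∀ {r t t' : ℝ}, 0 < r → r < t → t ≤ t' → t' < 1 →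
      laurentCoeff f r t' m n = laurentCoeff f r t m n := by
    intro r t t' hr hrt htt' ht'
    rw [laurentCoeff, laurentCoeff]
    congr 2
    ext a
    have hz : ‖(r : ℂ) * exp (a * I)‖ = r := by
      rw [norm_mul, norm_exp_ofReal_mul_I, norm_real, Real.norm_of_nonneg hr.le, mul_one]
    refine circle_integral_eq_of_annulus (g := fun w => ((r : ℂ) * exp (a * I)) ^ (-m) * w ^ (-n) *
      f ((r : ℂ) * exp (a * I), w)) (U := {w : ℂ | ((r : ℂ) * exp (a * I), w) ∈ hartogsTriangle})
      (isOpen_hartogsTriangle.preimage (by fun_prop)) ?_ (hr.trans hrt) htt' ?_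
    · intro w hw
      have hw0 : w ≠ 0 := by
        rintro rfl
        have := hw.1
        simp only [hz, norm_zero] at this
        linarith
      refine DifferentiableAt.differentiableWithinAt ?_
      refine (((differentiableAt_zpow.2 (Or.inl hw0)).const_mul _)).mul ?_
      exact (hf.differentiableAt (isOpen_hartogsTriangle.mem_nhds hw)).comp w (by fun_prop)
    · intro w h1 h2
      exact ⟨by rw [hz]; linarith, by simpa using h2.trans_lt ht'⟩
  have hcont : ∀ {r t : ℝ}, 0 < r → r < t → t < 1 → Continuous fun x : ℝ × ℝ =>
      ((r : ℂ) * exp (x.1 * I)) ^ (-m) * ((t : ℂ) * exp (x.2 * I)) ^ (-n) *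
      f ((r : ℂ) * exp (x.1 * I), (t : ℂ) * exp (x.2 * I)) := by
    intro r t hr hrt ht
    have hrc : (r : ℂ) ≠ 0 := by exact_mod_cast hr.ne'
    have htc : (t : ℂ) ≠ 0 := by exact_mod_cast (hr.trans hrt).ne'
    refine Continuous.mul (Continuous.mul ?_ ?_) (continuous_polar hf.continuousOn hr.le hrt ht)
    · exact Continuous.zpow₀ (by fun_prop) _ (fun x => Or.inl (by simp [hrc]))
    · exact Continuous.zpow₀ (by fun_prop) _ (fun x => Or.inl (by simp [htc]))
  have swap : ∀ {r t : ℝ}, 0 < r → r < t → t < 1 → laurentCoeff f r t m n =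
      (1 / (4 * Real.pi ^ 2) : ℝ) • ∫ b in (0 : ℝ)..(2 * Real.pi), ∫ a in (0 : ℝ)..(2 * Real.pi),
      ((r : ℂ) * exp (a * I)) ^ (-m) * ((t : ℂ) * exp (b * I)) ^ (-n) *
      f ((r : ℂ) * exp (a * I), (t : ℂ) * exp (b * I)) := by
    intro r t hr hrt ht
    rw [laurentCoeff]
    simp only [intervalIntegral.integral_of_le Real.two_pi_pos.le]
    rw [integral_integral_swap]
    rw [Measure.prod_restrict, ← Measure.volume_eq_prod]
    exact ((hcont hr hrt ht).continuousOn.integrableOn_compact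
      (isCompact_Icc.prod isCompact_Icc)).mono_set
      (prod_mono Ioc_subset_Icc_self Ioc_subset_Icc_self)
  have B : ∀ {r r' t : ℝ}, 0 < r → r ≤ r' → r' < t → t < 1 →
      laurentCoeff f r' t m n = laurentCoeff f r t m n := by
    intro r r' t hr hrr' hrt ht
    rw [swap hr (hrr'.trans_lt hrt) ht, swap (hr.trans_le hrr') hrt ht]
    congr 2
    ext b
    have hz : ‖(t : ℂ) * exp (b * I)‖ = t := by
      rw [norm_mul, norm_exp_ofReal_mul_I, norm_real, Real.norm_of_nonneg (by linarith), mul_one]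
    refine circle_integral_eq_of_annulus (g := fun z => z ^ (-m) * ((t : ℂ) * exp (b * I)) ^ (-n) *
      f (z, (t : ℂ) * exp (b * I)))
      (U := {z : ℂ | z ≠ 0 ∧ (z, (t : ℂ) * exp (b * I)) ∈ hartogsTriangle})
      (isOpen_ne.inter (isOpen_hartogsTriangle.preimage (by fun_prop))) ?_ hr hrr' ?_
    · intro z hw
      refine DifferentiableAt.differentiableWithinAt ?_
      refine (((differentiableAt_zpow.2 (Or.inl hw.1)).mul_const _)).mul ?_
      exact (hf.differentiableAt (isOpen_hartogsTriangle.mem_nhds hw.2)).comp z (by fun_prop)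
    · intro z h1 h2
      refine ⟨?_, ?_, ?_⟩
      · rintro rfl
        simp at h1
        linarith
      · simp only [hz]; linarith
      · simpa only [hz] using ht
  have h0 : 0 < min r r' := lt_min hr hr'
  have h1 := B h0 (min_le_left r r') hrt ht
  have h2 := B h0 (min_le_right r r') hrt' ht'
  rw [h1, h2]
  rcases le_total t t' with h | h
  · exact (A h0 ((min_le_left _ _).trans_lt hrt) h ht').symm
  · exact A h0 ((min_le_right _ _).trans_lt hrt') h ht

theorem continuous_laurent_integrand {f : ℂ × ℂ → ℂ} (hf : ContinuousOn f hartogsTriangle)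
    {r t : ℝ} (hr : 0 < r) (hrt : r < t) (ht : t < 1) (m n : ℤ) : Continuous fun x : ℝ × ℝ =>
      ((r : ℂ) * exp (x.1 * I)) ^ (-m) * ((t : ℂ) * exp (x.2 * I)) ^ (-n) *
      f ((r : ℂ) * exp (x.1 * I), (t : ℂ) * exp (x.2 * I)) := by
  have hrc : (r : ℂ) ≠ 0 := by exact_mod_cast hr.ne'
  have htc : (t : ℂ) ≠ 0 := by exact_mod_cast (hr.trans hrt).ne'
  refine Continuous.mul (Continuous.mul ?_ ?_) (continuous_polar hf hr.le hrt ht)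
  · exact Continuous.zpow₀ (by fun_prop) _ (fun x => Or.inl (by simp [hrc]))
  · exact Continuous.zpow₀ (by fun_prop) _ (fun x => Or.inl (by simp [htc]))

theorem laurentCoeff_add {f g : ℂ × ℂ → ℂ} (hf : ContinuousOn f hartogsTriangle)
    (hg : ContinuousOn g hartogsTriangle) {r t : ℝ} (hr : 0 < r) (hrt : r < t) (ht : t < 1)
    (m n : ℤ) : laurentCoeff (f + g) r t m n = laurentCoeff f r t m n + laurentCoeff g r t m n := by
  have cf := continuous_laurent_integrand hf hr hrt ht m n
  have cg := continuous_laurent_integrand hg hr hrt ht m n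
  rw [laurentCoeff, laurentCoeff, laurentCoeff, ← smul_add, ← intervalIntegral.integral_add]
  · congr 2
    ext a
    rw [← intervalIntegral.integral_add]
    · simp only [Pi.add_apply, mul_add]
    · exact (cf.comp (by fun_prop : Continuous fun b : ℝ => (a, b))).intervalIntegrable _ _
    · exact (cg.comp (by fun_prop : Continuous fun b : ℝ => (a, b))).intervalIntegrable _ _
  · exact (intervalIntegral.continuous_parametric_intervalIntegral_of_continuous' cf
      _ _).intervalIntegrable _ _
  · exact (intervalIntegral.continuous_parametric_intervalIntegral_of_continuous' cg
      _ _).intervalIntegrable _ _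

theorem laurentCoeff_smul (c : ℂ) (f : ℂ × ℂ → ℂ) (r t : ℝ) (m n : ℤ) :
    laurentCoeff (c • f) r t m n = c * laurentCoeff f r t m n := by
  simp only [laurentCoeff, Pi.smul_apply, smul_eq_mul, mul_left_comm _ c,
    intervalIntegral.integral_const_mul, mul_smul_comm]

theorem hardyMean_smul (c : ℂ) (f : ℂ × ℂ → ℂ) (s t : ℝ) :
    hardyMean (c • f) s t = ‖c‖ ^ 2 * hardyMean f s t := by
  simp only [hardyMean, Pi.smul_apply, smul_eq_mul, norm_mul, mul_pow, mul_assoc,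
    intervalIntegral.integral_const_mul]
  ring

theorem hardyMean_add_le {f g : ℂ × ℂ → ℂ} (hf : ContinuousOn f hartogsTriangle)
    (hg : ContinuousOn g hartogsTriangle) {s t : ℝ} (hs : s ∈ Ioo (0 : ℝ) 1)
    (ht : t ∈ Ioo (0 : ℝ) 1) :
    hardyMean (f + g) s t ≤ 2 * hardyMean f s t + 2 * hardyMean g s t := by
  refine hasSum_le ?_ (hasSum_hardyMean (hf.add hg) hs ht)
    (((hasSum_hardyMean hf hs ht).mul_left 2).add ((hasSum_hardyMean hg hs ht).mul_left 2))
  intro n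
  rw [laurentCoeff_add hf hg (mul_pos hs.1 ht.1) (by nlinarith [hs.1, hs.2, ht.1]) ht.2,
    ← mul_assoc 2, ← mul_assoc 2, ← add_mul]
  have := hs.1
  have := ht.1
  refine mul_le_mul_of_nonneg_right ?_ (by positivity)
  refine (pow_le_pow_left₀ (norm_nonneg _) (norm_add_le _ _) 2).trans ?_
  nlinarith [sq_nonneg (‖laurentCoeff f (s * t) t (n 0) (n 1)‖ -
    ‖laurentCoeff g (s * t) t (n 0) (n 1)‖)]

/-- The underlying vector space of the Hardy space `H²` of the Hartogs triangle: the holomorphic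
functions on the triangle whose means `hardyMean f s t`, `0 < s, t < 1`, are bounded. Functions on
the triangle are represented by their extension by zero to `ℂ × ℂ`, so that equality is equality on
the triangle. -/
def hardySubmodule : Submodule ℂ (ℂ × ℂ → ℂ) where
  carrier := {f | DifferentiableOn ℂ f hartogsTriangle ∧
    (∃ C : ℝ, ∀ s ∈ Ioo (0 : ℝ) 1, ∀ t ∈ Ioo (0 : ℝ) 1, hardyMean f s t ≤ C) ∧
    ∀ p, p ∉ hartogsTriangle → f p = 0}
  add_mem' := by
    rintro f g ⟨hf, ⟨C, hC⟩, hf0⟩ ⟨hg, ⟨D, hD⟩, hg0⟩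
    refine ⟨hf.add hg, ⟨2 * C + 2 * D, fun s hs t ht => ?_⟩, fun p hp => by
      simp [hf0 p hp, hg0 p hp]⟩
    have := hardyMean_add_le hf.continuousOn hg.continuousOn hs ht
    linarith [hC s hs t ht, hD s hs t ht]
  zero_mem' := ⟨differentiableOn_const 0, ⟨0, fun s _ t _ => by simp [hardyMean]⟩, fun _ _ => rfl⟩
  smul_mem' := by
    rintro c f ⟨hf, ⟨C, hC⟩, hf0⟩
    refine ⟨hf.const_smul c, ⟨‖c‖ ^ 2 * C, fun s hs t ht => ?_⟩, fun p hp => by simp [hf0 p hp]⟩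
    rw [hardyMean_smul]
    exact mul_le_mul_of_nonneg_left (hC s hs t ht) (by positivity)

/-- The exponent `(m, n)` of the monomial `z ^ m w ^ n = w⁻¹ (z / w) ^ i w ^ j`. -/
def hardyExp (p : ℕ × ℕ) : Fin 2 → ℤ := ![(p.1 : ℤ), (p.2 : ℤ) - p.1 - 1]

theorem hardyExp_injective : Function.Injective hardyExp := by
  rintro ⟨a, b⟩ ⟨c, d⟩ h
  have h0 := congrFun h 0
  have h1 := congrFun h 1
  simp [hardyExp] at h0 h1
  ext <;> simp <;> omega

theorem mem_range_hardyExp {n : Fin 2 → ℤ} (h0 : 0 ≤ n 0) (h1 : 0 ≤ n 0 + n 1 + 1) :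
    n ∈ range hardyExp := by
  refine ⟨((n 0).toNat, (n 0 + n 1 + 1).toNat), ?_⟩
  ext i
  fin_cases i
  · simp [hardyExp, h0]
  · simp [hardyExp, h0, h1]
    ring

theorem nonpos_of_forall_le_mul {x C : ℝ} (h : ∀ s ∈ Ioo (0 : ℝ) 1, x ≤ C * s) : x ≤ 0 := by
  have h1 : Tendsto (fun s : ℝ => C * s) (𝓝[>] 0) (𝓝 (C * 0)) :=
    ((continuous_const.mul continuous_id).tendsto 0).mono_left nhdsWithin_le_nhds
  rw [mul_zero] at h1
  exact ge_of_tendsto h1 (by filter_upwards [Ioo_mem_nhdsGT (zero_lt_one' ℝ)] using h)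

theorem mul_zpow_le_imp_zero {x C s : ℝ} (hx : 0 ≤ x) {k : ℤ} (hk : k < 0) (hs : s ∈ Ioo (0 : ℝ) 1)
    (h : x * s ^ k ≤ C) : x ≤ C * s := by
  have hs0 := hs.1
  have h1 : s ^ (-1 : ℤ) ≤ s ^ k := zpow_le_zpow_right_of_le_one₀ hs0 hs.2.le (by omega)
  have h2 : x * s ^ (-1 : ℤ) ≤ C := (mul_le_mul_of_nonneg_left h1 hx).trans h
  rw [zpow_neg_one, ← div_eq_mul_inv, div_le_iff₀ hs0] at h2
  exact h2

/-- The coefficient of `w⁻¹ (z / w) ^ i w ^ j` in the Laurent expansion of `f`. -/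
def hardyCoeff (f : ℂ × ℂ → ℂ) (p : ℕ × ℕ) : ℂ :=
  laurentCoeff f (1 / 4) (1 / 2) (hardyExp p 0) (hardyExp p 1)

theorem laurentCoeff_eq {f : ℂ × ℂ → ℂ} (hf : DifferentiableOn ℂ f hartogsTriangle)
    {s t : ℝ} (hs : s ∈ Ioo (0 : ℝ) 1) (ht : t ∈ Ioo (0 : ℝ) 1) (m n : ℤ) :
    laurentCoeff f (s * t) t m n = laurentCoeff f (1 / 4) (1 / 2) m n :=
  laurentCoeff_eq_of_radius hf (mul_pos hs.1 ht.1) (by nlinarith [hs.1, hs.2, ht.1]) ht.2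
    (by norm_num) (by norm_num) (by norm_num) m n

theorem hasSum_hardyCoeff {f : ℂ × ℂ → ℂ} (hf : f ∈ hardySubmodule) {s t : ℝ}
    (hs : s ∈ Ioo (0 : ℝ) 1) (ht : t ∈ Ioo (0 : ℝ) 1) :
    HasSum (fun p : ℕ × ℕ => ‖hardyCoeff f p‖ ^ 2 * (s ^ (2 * p.1 + 1) * t ^ (2 * p.2)))
      (hardyMean f s t) := by
  obtain ⟨hd, ⟨C, hC⟩, -⟩ := hf
  have key : ∀ s ∈ Ioo (0 : ℝ) 1, ∀ t ∈ Ioo (0 : ℝ) 1, HasSum (fun n : Fin 2 → ℤ =>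
      ‖laurentCoeff f (1 / 4) (1 / 2) (n 0) (n 1)‖ ^ 2 *
      (s ^ (2 * n 0 + 1) * t ^ (2 * (n 0 + n 1 + 1)))) (hardyMean f s t) := fun s hs t ht => by
    simpa only [laurentCoeff_eq hd hs ht] using hasSum_hardyMean hd.continuousOn hs ht
  have term : ∀ n : Fin 2 → ℤ, ∀ s ∈ Ioo (0 : ℝ) 1, ∀ t ∈ Ioo (0 : ℝ) 1,
      ‖laurentCoeff f (1 / 4) (1 / 2) (n 0) (n 1)‖ ^ 2 *
      (s ^ (2 * n 0 + 1) * t ^ (2 * (n 0 + n 1 + 1))) ≤ C := fun n s hs t ht =>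
    (le_hasSum (key s hs t ht) n fun m _ => by
      have := hs.1
      have := ht.1
      positivity).trans (hC s hs t ht)
  have half : (1 / 2 : ℝ) ∈ Ioo (0 : ℝ) 1 := by norm_num
  have hzero : ∀ n : Fin 2 → ℤ, n ∉ range hardyExp →
      laurentCoeff f (1 / 4) (1 / 2) (n 0) (n 1) = 0 := by
    intro n hn
    by_contra hne
    have hpos : 0 < ‖laurentCoeff f (1 / 4) (1 / 2) (n 0) (n 1)‖ ^ 2 := by positivity
    by_cases h0 : 0 ≤ n 0
    · have h1 : n 0 + n 1 + 1 < 0 := by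
        by_contra h1
        exact hn (mem_range_hardyExp h0 (not_lt.1 h1))
      have := nonpos_of_forall_le_mul (fun t ht => mul_zpow_le_imp_zero (C := C)
        (x := ‖laurentCoeff f (1 / 4) (1 / 2) (n 0) (n 1)‖ ^ 2 * (1 / 2 : ℝ) ^ (2 * n 0 + 1))
        (by positivity) (k := 2 * (n 0 + n 1 + 1)) (by omega) ht (by
          rw [mul_assoc]; exact term n _ half t ht))
      have h3 : 0 < ‖laurentCoeff f (1 / 4) (1 / 2) (n 0) (n 1)‖ ^ 2 * (1 / 2 : ℝ) ^ (2 * n 0 + 1) :=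
        by positivity
      linarith
    · have := nonpos_of_forall_le_mul (fun s hs => mul_zpow_le_imp_zero (C := C)
        (x := ‖laurentCoeff f (1 / 4) (1 / 2) (n 0) (n 1)‖ ^ 2 *
          (1 / 2 : ℝ) ^ (2 * (n 0 + n 1 + 1)))
        (by positivity) (k := 2 * n 0 + 1) (by omega) hs (by
          rw [mul_assoc, mul_comm ((1 / 2 : ℝ) ^ _)]; exact term n s hs _ half))
      have h3 : 0 < ‖laurentCoeff f (1 / 4) (1 / 2) (n 0) (n 1)‖ ^ 2 *
        (1 / 2 : ℝ) ^ (2 * (n 0 + n 1 + 1)) := by positivity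
      linarith
  have := (hardyExp_injective.hasSum_iff (fun n hn => by rw [hzero n hn]; simp)).2 (key s hs t ht)
  refine this.congr_fun fun p => ?_
  simp only [Function.comp_apply, hardyCoeff]
  congr 2
  simp only [hardyExp, Matrix.cons_val_zero, Matrix.cons_val_one]
  rw [← zpow_natCast]
  push_cast
  ring_nf

theorem sum_hardyCoeff_le {f : ℂ × ℂ → ℂ} (hf : f ∈ hardySubmodule) {C : ℝ}
    (hC : ∀ s ∈ Ioo (0 : ℝ) 1, ∀ t ∈ Ioo (0 : ℝ) 1, hardyMean f s t ≤ C) (F : Finset (ℕ × ℕ)) :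
    ∑ p ∈ F, ‖hardyCoeff f p‖ ^ 2 ≤ C := by
  have h1 : Tendsto (fun s : ℝ => ∑ p ∈ F, ‖hardyCoeff f p‖ ^ 2 *
      (s ^ (2 * p.1 + 1) * s ^ (2 * p.2))) (𝓝[<] 1) (𝓝 (∑ p ∈ F, ‖hardyCoeff f p‖ ^ 2 *
      ((1 : ℝ) ^ (2 * p.1 + 1) * 1 ^ (2 * p.2)))) :=
    (Continuous.tendsto (by fun_prop) 1).mono_left nhdsWithin_le_nhds
  simp only [one_pow, mul_one] at h1
  refine le_of_tendsto h1 ?_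
  filter_upwards [Ioo_mem_nhdsLT (zero_lt_one' ℝ)] with s hs
  have := hs.1
  exact (sum_le_hasSum F (fun p _ => by positivity) (hasSum_hardyCoeff hf hs hs)).trans (hC s hs s hs)

theorem summable_hardyCoeff {f : ℂ × ℂ → ℂ} (hf : f ∈ hardySubmodule) :
    Summable fun p => ‖hardyCoeff f p‖ ^ 2 := by
  obtain ⟨C, hC⟩ := hf.2.1
  exact summable_of_sum_le (fun _ => by positivity) (sum_hardyCoeff_le hf hC)

theorem hardyMean_le_tsum {f : ℂ × ℂ → ℂ} (hf : f ∈ hardySubmodule) {s t : ℝ}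
    (hs : s ∈ Ioo (0 : ℝ) 1) (ht : t ∈ Ioo (0 : ℝ) 1) :
    hardyMean f s t ≤ ∑' p, ‖hardyCoeff f p‖ ^ 2 := by
  refine hasSum_le (fun p => ?_) (hasSum_hardyCoeff hf hs ht) (summable_hardyCoeff hf).hasSum
  refine mul_le_of_le_one_right (by positivity) ?_
  exact mul_le_one₀ (pow_le_one₀ hs.1.le hs.2.le) (pow_nonneg ht.1.le _)
    (pow_le_one₀ ht.1.le ht.2.le)

theorem iSup_hardyMean {f : ℂ × ℂ → ℂ} (hf : f ∈ hardySubmodule) :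
    ⨆ r : Ioo (0 : ℝ) 1 × Ioo (0 : ℝ) 1, hardyMean f r.1 r.2 = ∑' p, ‖hardyCoeff f p‖ ^ 2 := by
  have half : (1 / 2 : ℝ) ∈ Ioo (0 : ℝ) 1 := by norm_num
  have : Nonempty (Ioo (0 : ℝ) 1 × Ioo (0 : ℝ) 1) := ⟨(⟨_, half⟩, ⟨_, half⟩)⟩
  refine le_antisymm (ciSup_le fun r => hardyMean_le_tsum hf r.1.2 r.2.2) ?_
  refine (summable_hardyCoeff hf).tsum_le_of_sum_le (sum_hardyCoeff_le hf fun s hs t ht => ?_)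
  exact le_ciSup (f := fun r : Ioo (0 : ℝ) 1 × Ioo (0 : ℝ) 1 => hardyMean f r.1 r.2)
    ⟨_, by rintro _ ⟨r, rfl⟩; exact hardyMean_le_tsum hf r.1.2 r.2.2⟩ (⟨s, hs⟩, ⟨t, ht⟩)

theorem eq_zero_of_hardyCoeff {f : ℂ × ℂ → ℂ} (hf : f ∈ hardySubmodule)
    (h : ∀ p, hardyCoeff f p = 0) : f = 0 := by
  have hd := hf.1
  have hmean : ∀ s ∈ Ioo (0 : ℝ) 1, ∀ t ∈ Ioo (0 : ℝ) 1, hardyMean f s t = 0 := by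
    intro s hs t ht
    have := hasSum_hardyCoeff hf hs ht
    simp only [h, norm_zero, ne_eq, OfNat.ofNat_ne_zero, not_false_eq_true, zero_pow,
      zero_mul] at this
    exact this.unique hasSum_zero
  have h1 : ∀ z w : ℂ, z ≠ 0 → (z, w) ∈ hartogsTriangle → f (z, w) = 0 := by
    intro z w hz hzw
    have hz0 : 0 < ‖z‖ := norm_pos_iff.2 hz
    have hw0 : 0 < ‖w‖ := hz0.trans hzw.1
    have hs : ‖z‖ / ‖w‖ ∈ Ioo (0 : ℝ) 1 := ⟨div_pos hz0 hw0, (div_lt_one hw0).2 hzw.1⟩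
    have ht : ‖w‖ ∈ Ioo (0 : ℝ) 1 := ⟨hw0, hzw.2⟩
    have h2 := hasSum_hardyMean hd.continuousOn hs ht
    rw [hmean _ hs _ ht, div_mul_cancel₀ _ hw0.ne',
      hasSum_zero_iff_of_nonneg (fun n => by positivity)] at h2
    have h3 : ∀ n, UnitAddTorus.mFourierCoeff
        (polarMap f hd.continuousOn ‖z‖ ‖w‖ hz0.le hzw.1 hzw.2) n = 0 := by
      intro n
      have h4 := congrFun h2 n
      simp only [Pi.zero_apply, mul_eq_zero, ne_eq, OfNat.ofNat_ne_zero, not_false_eq_true,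
        pow_eq_zero_iff, norm_eq_zero] at h4
      rw [mFourierCoeff_polarMap hd.continuousOn hz0 hzw.1 hzw.2]
      rcases h4 with h4 | h4 | h4
      · rw [h4, mul_zero]
      · exact absurd h4 (zpow_pos hs.1 _).ne'
      · exact absurd h4 (zpow_pos ht.1 _).ne'
    have h5 := UnitAddTorus.hasSum_mFourier_series_apply_of_summable
      (f := polarMap f hd.continuousOn ‖z‖ ‖w‖ hz0.le hzw.1 hzw.2)
      (by rw [show UnitAddTorus.mFourierCoeff _ = 0 from funext h3]; exact summable_zero)
      (fun i => ((![arg z / (2 * Real.pi), arg w / (2 * Real.pi)] i : ℝ) : UnitAddCircle))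
    simp only [h3, zero_smul] at h5
    have h6 := h5.unique hasSum_zero
    have hpi : (2 * Real.pi) ≠ 0 := by positivity
    simpa only [polarMap, ContinuousMap.coe_mk, fourier_two_pi, zpow_one, Matrix.cons_val_zero,
      Matrix.cons_val_one, mul_div_cancel₀ _ hpi, norm_mul_exp_arg_mul_I] using h6
  ext ⟨z, w⟩
  by_cases hzw : (z, w) ∈ hartogsTriangle
  · by_cases hz : z = 0
    · subst hz
      have hc : ContinuousAt (fun z : ℂ => f (z, w)) 0 :=
        (hd.continuousOn.continuousAt (isOpen_hartogsTriangle.mem_nhds hzw)).comp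
          (f := fun z : ℂ => (z, w)) (by fun_prop)
      have h7 : ∀ᶠ z : ℂ in 𝓝[≠] 0, f (z, w) = 0 := by
        have : ∀ᶠ z : ℂ in 𝓝 0, (z, w) ∈ hartogsTriangle :=
          (isOpen_hartogsTriangle.preimage
            (by fun_prop : Continuous fun z : ℂ => (z, w))).mem_nhds hzw
        filter_upwards [self_mem_nhdsWithin, nhdsWithin_le_nhds this] with z hz hzw
        exact h1 z w hz hzw
      exact tendsto_nhds_unique (hc.tendsto.mono_left nhdsWithin_le_nhds)
        (tendsto_const_nhds.congr' (h7.mono fun z hz => hz.symm))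
    · exact h1 z w hz hzw
  · exact hf.2.2 _ hzw

/-- The sum of the power series with coefficients `A` at `q = (u, v)`. -/
def bidiscSeries (A : ℕ × ℕ → ℂ) (q : ℂ × ℂ) : ℂ := ∑' p : ℕ × ℕ, A p * (q.1 ^ p.1 * q.2 ^ p.2)

theorem summable_geom_prod {a b : ℝ} (ha : 0 ≤ a) (ha1 : a < 1) (hb : 0 ≤ b) (hb1 : b < 1) :
    Summable fun p : ℕ × ℕ => a ^ p.1 * b ^ p.2 :=
  (summable_geometric_of_lt_one ha ha1).mul_of_nonneg (summable_geometric_of_lt_one hb hb1)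
    (fun _ => pow_nonneg ha _) (fun _ => pow_nonneg hb _)

theorem summable_bidiscSeries {A : ℕ × ℕ → ℂ} {B : ℝ} (hA : ∀ p, ‖A p‖ ≤ B) {q : ℂ × ℂ}
    (h1 : ‖q.1‖ < 1) (h2 : ‖q.2‖ < 1) : Summable fun p : ℕ × ℕ => ‖A p * (q.1 ^ p.1 * q.2 ^ p.2)‖ := by
  refine Summable.of_nonneg_of_le (fun _ => norm_nonneg _) (fun p => ?_)
    ((summable_geom_prod (norm_nonneg q.1) h1 (norm_nonneg q.2) h2).mul_left B)
  rw [norm_mul, norm_mul, norm_pow, norm_pow]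
  exact mul_le_mul_of_nonneg_right (hA p) (by positivity)

theorem differentiableAt_bidiscSeries {A : ℕ × ℕ → ℂ} {B : ℝ} (hA : ∀ p, ‖A p‖ ≤ B) {q : ℂ × ℂ}
    (h1 : ‖q.1‖ < 1) (h2 : ‖q.2‖ < 1) : DifferentiableAt ℂ (bidiscSeries A) q := by
  have hB : 0 ≤ B := (norm_nonneg _).trans (hA 0)
  obtain ⟨ρ, hρ, hρ1⟩ := exists_between (max_lt h1 h2)
  have hρ0 : 0 < ρ := ((norm_nonneg _).trans (le_max_left _ _)).trans_lt hρ
  have hg : Summable fun n : ℕ => ρ ^ n := summable_geometric_of_lt_one hρ0.le hρ1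
  have hng : Summable fun n : ℕ => (n : ℝ) * ρ ^ (n - 1) := by
    rw [← summable_nat_add_iff 1]
    have := (summable_pow_mul_geometric_of_norm_lt_one (R := ℝ) 1 (r := ρ)
      (by rwa [Real.norm_of_nonneg hρ0.le])).add hg
    refine this.congr fun n => ?_
    simp
    ring
  have hu : Summable fun p : ℕ × ℕ => B * (ρ ^ p.1 * (p.2 * ρ ^ (p.2 - 1)) +
      (p.1 * ρ ^ (p.1 - 1)) * ρ ^ p.2) :=
    ((hg.mul_of_nonneg hng (fun _ => by positivity) (fun _ => by positivity)).add
      (hng.mul_of_nonneg hg (fun _ => by positivity) (fun _ => by positivity))).mul_left B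
  have hball : ∀ x : ℂ × ℂ, x ∈ Metric.ball (0 : ℂ × ℂ) ρ → ‖x.1‖ < ρ ∧ ‖x.2‖ < ρ := by
    intro x hx
    rw [mem_ball_zero_iff, Prod.norm_def] at hx
    exact max_lt_iff.1 hx
  refine (hasFDerivAt_tsum_of_isPreconnected
    (f' := fun p x => A p • (x.1 ^ p.1 • (((p.2 : ℂ) * x.2 ^ (p.2 - 1)) • ContinuousLinearMap.snd ℂ ℂ ℂ) +
      x.2 ^ p.2 • (((p.1 : ℂ) * x.1 ^ (p.1 - 1)) • ContinuousLinearMap.fst ℂ ℂ ℂ))) hu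
    Metric.isOpen_ball (convex_ball (0 : ℂ × ℂ) ρ).isPreconnected ?_ ?_ (Metric.mem_ball_self hρ0)
    ?_ (by rw [mem_ball_zero_iff]; exact hρ)).differentiableAt
  · intro p x _
    refine HasFDerivAt.const_mul ?_ _
    refine HasFDerivAt.mul ?_ ?_
    · exact (hasDerivAt_pow p.1 x.1).comp_hasFDerivAt x hasFDerivAt_fst
    · exact (hasDerivAt_pow p.2 x.2).comp_hasFDerivAt x hasFDerivAt_snd
  · intro p x hx
    obtain ⟨hx1, hx2⟩ := hball x hx
    rw [norm_smul]
    refine mul_le_mul (hA p) ((norm_add_le _ _).trans (add_le_add ?_ ?_)) (norm_nonneg _) hB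
    · rw [norm_smul, norm_smul, norm_pow, norm_mul, norm_pow, Complex.norm_natCast]
      have := ContinuousLinearMap.norm_snd_le ℂ ℂ ℂ
      calc _ ≤ ρ ^ p.1 * (p.2 * ρ ^ (p.2 - 1) * 1) := by gcongr
        _ = _ := by ring
    · rw [norm_smul, norm_smul, norm_pow, norm_mul, norm_pow, Complex.norm_natCast]
      have := ContinuousLinearMap.norm_fst_le ℂ ℂ ℂ
      calc _ ≤ ρ ^ p.2 * (p.1 * ρ ^ (p.1 - 1) * 1) := by gcongr
        _ = _ := by ring
  · exact (summable_bidiscSeries (q := 0) hA (by simp) (by simp)).of_norm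

open Classical in
/-- The function `∑ A i j w⁻¹ (z / w) ^ i w ^ j` on the triangle, extended by zero. -/
def hartogsSeries (A : ℕ × ℕ → ℂ) (q : ℂ × ℂ) : ℂ :=
  if q ∈ hartogsTriangle then q.2⁻¹ * bidiscSeries A (q.1 / q.2, q.2) else 0

theorem snd_ne_zero {q : ℂ × ℂ} (hq : q ∈ hartogsTriangle) : q.2 ≠ 0 :=
  norm_pos_iff.1 ((norm_nonneg _).trans_lt hq.1)

theorem norm_div_lt_one {q : ℂ × ℂ} (hq : q ∈ hartogsTriangle) : ‖q.1 / q.2‖ < 1 := by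
  rw [norm_div, div_lt_one (norm_pos_iff.2 (snd_ne_zero hq))]
  exact hq.1

theorem differentiableOn_hartogsSeries {A : ℕ × ℕ → ℂ} {B : ℝ} (hA : ∀ p, ‖A p‖ ≤ B) :
    DifferentiableOn ℂ (hartogsSeries A) hartogsTriangle := by
  have : DifferentiableOn ℂ (fun q : ℂ × ℂ => q.2⁻¹ * bidiscSeries A (q.1 / q.2, q.2))
      hartogsTriangle := by
    intro q hq
    have h0 := snd_ne_zero hq
    refine DifferentiableAt.differentiableWithinAt ?_
    refine DifferentiableAt.mul (by fun_prop (disch := assumption)) ?_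
    exact (differentiableAt_bidiscSeries (q := (q.1 / q.2, q.2)) hA (norm_div_lt_one hq) hq.2).comp
      (f := fun q : ℂ × ℂ => (q.1 / q.2, q.2)) q
      (by fun_prop (disch := assumption))
  exact this.congr fun q hq => if_pos hq

theorem laurentCoeff_hartogsSeries {A : ℕ × ℕ → ℂ} {B : ℝ} (hA : ∀ p, ‖A p‖ ≤ B) {s t : ℝ}
    (hs : s ∈ Ioo (0 : ℝ) 1) (ht : t ∈ Ioo (0 : ℝ) 1) (n : Fin 2 → ℤ) :
    HasSum (fun p : ℕ × ℕ => A p * if n = hardyExp p then 1 else 0)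
      (laurentCoeff (hartogsSeries A) (s * t) t (n 0) (n 1)) := by
  have hr : 0 < s * t := mul_pos hs.1 ht.1
  have hrt : s * t < t := by nlinarith [hs.1, hs.2, ht.1]
  have hs0 : (s : ℂ) ≠ 0 := by exact_mod_cast hs.1.ne'
  have ht0 : (t : ℂ) ≠ 0 := by exact_mod_cast ht.1.ne'
  have hc := (differentiableOn_hartogsSeries hA).continuousOn
  set P := polarMap (hartogsSeries A) hc (s * t) t hr.le hrt ht.2 with hP
  let c : ℕ × ℕ → ℂ := fun p => (t : ℂ)⁻¹ * (A p * ((s : ℂ) ^ p.1 * (t : ℂ) ^ p.2))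
  have hcs : Summable fun p => c p • UnitAddTorus.mFourier (hardyExp p) := by
    refine Summable.of_norm ?_
    simp only [norm_smul, UnitAddTorus.mFourier_norm, mul_one]
    simp only [c]
    simp only [norm_mul (t : ℂ)⁻¹]
    exact (summable_bidiscSeries (q := ((s : ℂ), (t : ℂ))) hA (by simpa [abs_of_pos hs.1] using hs.2)
      (by simpa [abs_of_pos ht.1] using ht.2)).mul_left _
  have hsum : HasSum (fun p => c p • UnitAddTorus.mFourier (hardyExp p)) P := by
    convert! hcs.hasSum
    ext x
    have h1 := ((ContinuousMap.evalCLM ℂ x).hasSum hcs.hasSum).tsum_eq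
    refine Eq.trans ?_ h1
    have hx : ∀ y : UnitAddCircle, ‖fourier 1 y‖ = 1 := fun y => by
      rw [fourier_apply]; exact Circle.norm_coe _
    have hmem : ((((s * t : ℝ) : ℂ)) * fourier 1 (x 0), (t : ℂ) * fourier 1 (x 1)) ∈
        hartogsTriangle := by
      simp only [hartogsTriangle, mem_ofPred_eq, norm_mul _ (fourier 1 _), hx, norm_real,
        Real.norm_eq_abs, abs_of_pos hr, abs_of_pos ht.1, mul_one]
      exact ⟨hrt, ht.2⟩
    have h0 : ∀ y : UnitAddCircle, fourier 1 y ≠ 0 := fun y =>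
      norm_pos_iff.1 (by rw [hx]; exact one_pos)
    have hpow : ∀ (k : ℤ) (y : UnitAddCircle), fourier k y = fourier 1 y ^ k := fun k y => by
      induction y using QuotientAddGroup.induction_on with
      | H z => exact (fourier_two_pi z k).trans (by rw [fourier_two_pi z 1, zpow_one])
    simp only [hP, polarMap, ContinuousMap.coe_mk, hartogsSeries, if_pos hmem, bidiscSeries]
    rw [← tsum_mul_left]
    refine tsum_congr fun p => ?_
    change _ = c p * UnitAddTorus.mFourier (hardyExp p) x
    simp only [c, UnitAddTorus.mFourier, ContinuousMap.coe_mk, Fin.prod_univ_two,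
      hardyExp, Matrix.cons_val_zero, Matrix.cons_val_one]
    rw [hpow p.1, hpow (p.2 - p.1 - 1), zpow_sub₀ (h0 _), zpow_sub₀ (h0 _), zpow_natCast, zpow_natCast, zpow_natCast, zpow_one,
      ofReal_mul]
    have := h0 (x 0)
    have := h0 (x 1)
    rw [mul_right_comm (s : ℂ), mul_comm _ (t : ℂ), mul_div_mul_left _ _ ht0, div_pow, mul_pow, mul_pow]
    field_simp
  have hL := ((innerSL ℂ (UnitAddTorus.mFourierLp 2 n)).comp
    (ContinuousMap.toLp (E := ℂ) 2 (Measure.pi fun _ : Fin 2 => AddCircle.haarAddCircle (T := 1)) ℂ)).hasSum hsum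
  have hLP : ((innerSL ℂ (UnitAddTorus.mFourierLp 2 n)).comp
    (ContinuousMap.toLp (E := ℂ) 2 (Measure.pi fun _ : Fin 2 => AddCircle.haarAddCircle (T := 1)) ℂ)) P =
      UnitAddTorus.mFourierCoeff P n := by
    have h1 := (UnitAddTorus.mFourierBasis_repr (ContinuousMap.toLp (E := ℂ) 2 (Measure.pi fun _ : Fin 2 => AddCircle.haarAddCircle (T := 1)) ℂ P) n).trans (UnitAddTorus.mFourierCoeff_toLp P n)
    rw [HilbertBasis.repr_apply_apply, UnitAddTorus.coe_mFourierBasis] at h1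
    exact h1
  rw [hLP, hP, mFourierCoeff_polarMap hc hr hrt ht.2] at hL
  have hne : ((s * t : ℝ) : ℂ) ^ n 0 * (t : ℂ) ^ n 1 ≠ 0 := by
    have : ((s * t : ℝ) : ℂ) ≠ 0 := by exact_mod_cast hr.ne'
    exact mul_ne_zero (zpow_ne_zero _ this) (zpow_ne_zero _ ht0)
  have h2 := hL.mul_left (((s * t : ℝ) : ℂ) ^ n 0 * (t : ℂ) ^ n 1)⁻¹
  rw [inv_mul_cancel_left₀ hne] at h2
  refine h2.congr_fun fun p => ?_
  have ho := (orthonormal_iff_ite.1 (UnitAddTorus.orthonormal_mFourier (d := Fin 2))) n (hardyExp p)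
  have e : ((innerSL ℂ (UnitAddTorus.mFourierLp 2 n)).comp
    (ContinuousMap.toLp (E := ℂ) 2 (Measure.pi fun _ : Fin 2 => AddCircle.haarAddCircle (T := 1)) ℂ))
      (c p • UnitAddTorus.mFourier (hardyExp p)) = c p * if n = hardyExp p then 1 else 0 := by
    rw [map_smul, smul_eq_mul]
    exact congrArg _ ho
  refine Eq.trans ?_ (congrArg _ e.symm)
  split_ifs with h
  · subst h
    simp only [c, hardyExp, Matrix.cons_val_zero, Matrix.cons_val_one]
    rw [zpow_sub₀ ht0, zpow_sub₀ ht0, zpow_natCast, zpow_natCast, zpow_natCast, zpow_one, ofReal_mul,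
      mul_pow]
    field_simp
  · simp

theorem hardyCoeff_hartogsSeries {A : ℕ × ℕ → ℂ} {B : ℝ} (hA : ∀ p, ‖A p‖ ≤ B) (p : ℕ × ℕ) :
    hardyCoeff (hartogsSeries A) p = A p := by
  have half : (1 / 2 : ℝ) ∈ Ioo (0 : ℝ) 1 := by norm_num
  have h := laurentCoeff_hartogsSeries hA half half (hardyExp p)
  rw [laurentCoeff_eq (differentiableOn_hartogsSeries hA) half half] at h
  have h1 := hasSum_single (f := fun q => A q * if hardyExp p = hardyExp q then (1 : ℂ) else 0) p
    fun q hq => by rw [if_neg fun h => hq (hardyExp_injective h).symm, mul_zero]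
  rw [if_pos rfl, mul_one] at h1
  exact h.unique h1

theorem hartogsSeries_mem {A : ℕ × ℕ → ℂ} (hA : Summable fun p => ‖A p‖ ^ 2) :
    hartogsSeries A ∈ hardySubmodule := by
  have hB : ∀ p, ‖A p‖ ≤ √(∑' p, ‖A p‖ ^ 2) := fun p =>
    Real.le_sqrt_of_sq_le (hA.le_tsum p fun _ _ => by positivity)
  have hd := differentiableOn_hartogsSeries hB
  refine ⟨hd, ⟨∑' p, ‖A p‖ ^ 2, fun s hs t ht => ?_⟩, fun p hp => if_neg hp⟩
  have h := hasSum_hardyMean hd.continuousOn hs ht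
  have hz : ∀ n : Fin 2 → ℤ, n ∉ range hardyExp →
      laurentCoeff (hartogsSeries A) (s * t) t (n 0) (n 1) = 0 := fun n hn =>
    (laurentCoeff_hartogsSeries hB hs ht n).unique (hasSum_zero.congr_fun fun p => by
      rw [if_neg fun h => hn ⟨p, h.symm⟩, mul_zero])
  rw [← hardyExp_injective.hasSum_iff (fun n hn => by rw [hz n hn]; simp)] at h
  refine hasSum_le (fun p => ?_) h hA.hasSum
  simp only [Function.comp_apply]
  rw [laurentCoeff_eq hd hs ht, ← hardyCoeff, hardyCoeff_hartogsSeries hB]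
  refine mul_le_of_le_one_right (by positivity) ?_
  have e1 : 2 * hardyExp p 0 + 1 = ((2 * p.1 + 1 : ℕ) : ℤ) := by simp [hardyExp]
  have e2 : 2 * (hardyExp p 0 + hardyExp p 1 + 1) = ((2 * p.2 : ℕ) : ℤ) := by
    simp [hardyExp]
    ring
  rw [e1, e2, zpow_natCast, zpow_natCast]
  exact mul_le_one₀ (pow_le_one₀ hs.1.le hs.2.le) (pow_nonneg ht.1.le _)
    (pow_le_one₀ ht.1.le ht.2.le)

/-- The Hardy space `H²` of the Hartogs triangle as a type; the instances below make it a Hilbert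
space. -/
def HardySpace : Type := hardySubmodule

namespace HardySpace

instance : AddCommGroup HardySpace := inferInstanceAs (AddCommGroup hardySubmodule)

instance : Module ℂ HardySpace := inferInstanceAs (Module ℂ hardySubmodule)

/-- The underlying function of an element of `H²`. -/
def toFun (f : HardySpace) : ℂ × ℂ → ℂ := (show hardySubmodule from f).1

instance : CoeFun HardySpace fun _ => ℂ × ℂ → ℂ := ⟨toFun⟩

/-- The element of `H²` given by a function with the defining properties. -/
def ofMem (f : ℂ × ℂ → ℂ) (hf : f ∈ hardySubmodule) : HardySpace :=
  (⟨f, hf⟩ : hardySubmodule)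

theorem mem (f : HardySpace) : f.toFun ∈ hardySubmodule := Subtype.property _

theorem ext {f g : HardySpace} (h : ∀ p ∈ hartogsTriangle, f p = g p) : f = g :=
  Subtype.ext <| funext fun p => by
    by_cases hp : p ∈ hartogsTriangle
    · exact h p hp
    · exact (f.mem.2.2 p hp).trans (g.mem.2.2 p hp).symm

theorem add_apply (f g : HardySpace) (p : ℂ × ℂ) : (f + g) p = f p + g p := rfl

theorem smul_apply (c : ℂ) (f : HardySpace) (p : ℂ × ℂ) : (c • f) p = c * f p := rfl

/-- The Hardy norm: `‖f‖²` is the supremum of the means `hardyMean f s t` over `0 < s, t < 1`. -/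
instance : Norm HardySpace :=
  ⟨fun f => √(⨆ r : Ioo (0 : ℝ) 1 × Ioo (0 : ℝ) 1, hardyMean f r.1 r.2)⟩

theorem norm_def (f : HardySpace) :
    ‖f‖ = √(⨆ r : Ioo (0 : ℝ) 1 × Ioo (0 : ℝ) 1, hardyMean f r.1 r.2) := rfl

theorem memℓp_hardyCoeff (f : HardySpace) : Memℓp (E := fun _ : ℕ × ℕ => ℂ) (hardyCoeff f) 2 :=
  (memℓp_gen_iff (by norm_num)).2 (by simpa using summable_hardyCoeff f.mem)

/-- The coefficients of `f` with respect to the monomials `w⁻¹ (z / w) ^ i w ^ j`. -/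
def coeffMap : HardySpace →ₗ[ℂ] lp (fun _ : ℕ × ℕ => ℂ) 2 where
  toFun f := ⟨hardyCoeff f, memℓp_hardyCoeff f⟩
  map_add' f g := lp.ext <| funext fun p =>
    laurentCoeff_add f.mem.1.continuousOn g.mem.1.continuousOn (by norm_num) (by norm_num)
      (by norm_num) _ _
  map_smul' c f := lp.ext <| funext fun p => laurentCoeff_smul c f _ _ _ _

theorem coeffMap_apply (f : HardySpace) (p : ℕ × ℕ) : coeffMap f p = hardyCoeff f p := rfl

theorem coeffMap_bijective : Function.Bijective coeffMap := by
  constructor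
  · rw [← LinearMap.ker_eq_bot, LinearMap.ker_eq_bot']
    intro f hf
    have h := eq_zero_of_hardyCoeff f.mem fun p => by rw [← coeffMap_apply, hf]; rfl
    exact ext fun p _ => congrFun h p
  · intro A
    have hA : Summable fun p => ‖A p‖ ^ 2 := by
      simpa using (memℓp_gen_iff (by norm_num)).1 A.2
    exact ⟨ofMem _ (hartogsSeries_mem hA), lp.ext <| funext fun p =>
      hardyCoeff_hartogsSeries (B := ‖A‖) (fun p => lp.norm_apply_le_norm (by norm_num) A p) p⟩

theorem norm_coeffMap (f : HardySpace) : ‖coeffMap f‖ = ‖f‖ := by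
  rw [norm_def, iSup_hardyMean f.mem]
  have h := lp.norm_rpow_eq_tsum (p := 2) (by norm_num) (coeffMap f)
  simp only [ENNReal.toReal_ofNat, Real.rpow_ofNat, coeffMap_apply] at h
  rw [← h, Real.sqrt_sq (norm_nonneg _)]

theorem normedSpaceCore : NormedSpace.Core ℂ HardySpace where
  norm_nonneg f := Real.sqrt_nonneg _
  norm_smul c f := by rw [← norm_coeffMap, ← norm_coeffMap, map_smul, norm_smul]
  norm_triangle f g := by
    simp only [← norm_coeffMap, map_add]
    exact norm_add_le _ _
  norm_eq_zero_iff f := by rw [← norm_coeffMap, norm_eq_zero, map_eq_zero_iff _ coeffMap_bijective.1]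

instance : NormedAddCommGroup HardySpace := NormedAddCommGroup.ofCore normedSpaceCore

instance : NormedSpace ℂ HardySpace := NormedSpace.ofCore normedSpaceCore

/-- The inner product of `H²`, obtained from the Hardy norm by polarization. -/
instance : InnerProductSpace ℂ HardySpace := InnerProductSpace.ofNorm ℂ fun f g => by
  have := parallelogram_law_with_norm ℂ (coeffMap f) (coeffMap g)
  rwa [← map_add, ← map_sub, norm_coeffMap, norm_coeffMap, norm_coeffMap,
    norm_coeffMap, pow_two, pow_two, pow_two, pow_two] at this

instance : CompleteSpace HardySpace :=
  let e : HardySpace ≃ₗᵢ[ℂ] lp (fun _ : ℕ × ℕ => ℂ) 2 := 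
    ⟨LinearEquiv.ofBijective coeffMap coeffMap_bijective, norm_coeffMap⟩
  e.symm.isometry.isUniformInducing.completeSpace_congr e.symm.surjective |>.1 inferInstance

end HardySpace

theorem hardyMean_mul_le {f φ : ℂ × ℂ → ℂ} (hf : ContinuousOn f hartogsTriangle)
    (hφ : ContinuousOn φ hartogsTriangle) (hb : ∀ p ∈ hartogsTriangle, ‖φ p‖ ≤ 1)
    {s t : ℝ} (hs : s ∈ Ioo (0 : ℝ) 1) (ht : t ∈ Ioo (0 : ℝ) 1) :
    hardyMean (fun p => φ p * f p) s t ≤ hardyMean f s t := by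
  have hr : 0 < s * t := mul_pos hs.1 ht.1
  have hrt : s * t < t := by nlinarith [hs.1, hs.2, ht.1]
  have hs0 := hs.1
  have hcont : ∀ {g : ℂ × ℂ → ℂ}, ContinuousOn g hartogsTriangle → Continuous fun x : ℝ × ℝ =>
      ‖g (s * t * exp (x.1 * I), t * exp (x.2 * I))‖ ^ 2 * (s * t ^ 2) := fun hg => by
    have := continuous_polar hg hr.le hrt ht.2
    rw [ofReal_mul] at this
    exact (this.norm.pow 2).mul continuous_const
  have h1 := hcont (hφ.mul hf)
  have h2 := hcont hf
  refine mul_le_mul_of_nonneg_left ?_ (by positivity)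
  refine intervalIntegral.integral_mono_on Real.two_pi_pos.le
    ((intervalIntegral.continuous_parametric_intervalIntegral_of_continuous' h1
      _ _).intervalIntegrable _ _)
    ((intervalIntegral.continuous_parametric_intervalIntegral_of_continuous' h2
      _ _).intervalIntegrable _ _) fun a _ => ?_
  refine intervalIntegral.integral_mono_on Real.two_pi_pos.le
    ((h1.comp (by fun_prop : Continuous fun b : ℝ => (a, b))).intervalIntegrable _ _)
    ((h2.comp (by fun_prop : Continuous fun b : ℝ => (a, b))).intervalIntegrable _ _) fun b _ => ?_
  have hm := mem_hartogsTriangle_polar hr.le hrt ht.2 a b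
  rw [ofReal_mul] at hm
  refine mul_le_mul_of_nonneg_right (pow_le_pow_left₀ (norm_nonneg _) ?_ 2) (by positivity)
  rw [norm_mul]
  exact mul_le_of_le_one_left (norm_nonneg _) (hb _ hm)

/-- Multiplication by a holomorphic function `φ` with `|φ| ≤ 1` on the triangle. -/
def mulOp (φ : ℂ × ℂ → ℂ) (hφ : DifferentiableOn ℂ φ hartogsTriangle)
    (hb : ∀ p ∈ hartogsTriangle, ‖φ p‖ ≤ 1) : HardySpace →L[ℂ] HardySpace :=
  LinearMap.mkContinuous
    { toFun := fun f => .ofMem (fun p => φ p * f p) ⟨hφ.mul f.mem.1,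
        f.mem.2.1.imp fun _ hC s hs t ht => (hardyMean_mul_le f.mem.1.continuousOn hφ.continuousOn
          hb hs ht).trans (hC s hs t ht),
        fun p hp => mul_eq_zero_of_right _ (f.mem.2.2 p hp)⟩
      map_add' := fun f g => HardySpace.ext fun p _ => mul_add _ _ _
      map_smul' := fun c f => HardySpace.ext fun p _ => mul_left_comm _ _ _ } 1 fun f => by
    rw [one_mul]
    refine Real.sqrt_le_sqrt (ciSup_mono ?_ fun r => ?_)
    · obtain ⟨C, hC⟩ := f.mem.2.1
      exact ⟨C, by rintro _ ⟨r, rfl⟩; exact hC _ r.1.2 _ r.2.2⟩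
    · exact hardyMean_mul_le f.mem.1.continuousOn hφ.continuousOn hb r.1.2 r.2.2

/-- `M_z`, multiplication by the first coordinate. -/
def Mz : HardySpace →L[ℂ] HardySpace :=
  mulOp Prod.fst differentiableOn_fst fun _ hp => (hp.1.trans hp.2).le

/-- `M_w`, multiplication by the second coordinate. -/
def Mw : HardySpace →L[ℂ] HardySpace :=
  mulOp Prod.snd differentiableOn_snd fun _ hp => hp.2.le

/-- A quotient module of `H²`: a closed subspace that is invariant under `M_z*` and `M_w*`. -/
structure QuotientModule where
  toSubmodule : Submodule ℂ HardySpace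
  isClosed : IsClosed (toSubmodule : Set HardySpace)
  adjoint_Mz_mem : ∀ f ∈ toSubmodule, ContinuousLinearMap.adjoint Mz f ∈ toSubmodule
  adjoint_Mw_mem : ∀ f ∈ toSubmodule, ContinuousLinearMap.adjoint Mw f ∈ toSubmodule

instance (Q : QuotientModule) : CompleteSpace Q.toSubmodule := Q.isClosed.completeSpace_coe

/-- The compression `P_Q T|_Q` of an operator `T` to `Q`. -/
def QuotientModule.compression (Q : QuotientModule) (T : HardySpace →L[ℂ] HardySpace) :
    Q.toSubmodule →L[ℂ] Q.toSubmodule :=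
  Q.toSubmodule.orthogonalProjectionOnto ∘L T ∘L Q.toSubmodule.subtypeL

/-- `Q` is doubly commuting if `[Q_z*, Q_w] = 0` for the compressions `Q_z`, `Q_w` of `M_z`, `M_w`. -/
def QuotientModule.IsDoublyCommuting (Q : QuotientModule) : Prop :=
  ContinuousLinearMap.adjoint (Q.compression Mz) ∘L Q.compression Mw -
    Q.compression Mw ∘L ContinuousLinearMap.adjoint (Q.compression Mz) = 0

/-- The subspace `θ H²` of all products `θ f` with `f ∈ H²` (that lie in `H²`, which is automatic for
bounded holomorphic `θ`). -/
def multiples (θ : ℂ × ℂ → ℂ) : Submodule ℂ HardySpace where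
  carrier := {g | ∃ f : HardySpace, ∀ p ∈ hartogsTriangle, g p = θ p * f p}
  add_mem' := by
    rintro _ _ ⟨f, hf⟩ ⟨g, hg⟩
    refine ⟨f + g, fun p hp => ?_⟩
    rw [HardySpace.add_apply, HardySpace.add_apply, hf p hp, hg p hp, mul_add]
  zero_mem' := ⟨0, fun p _ => (mul_zero _).symm⟩
  smul_mem' := by
    rintro c _ ⟨f, hf⟩
    refine ⟨c • f, fun p hp => ?_⟩
    rw [HardySpace.smul_apply, HardySpace.smul_apply, hf p hp, mul_left_comm]

theorem mulOp_mem_multiples (θ : ℂ × ℂ → ℂ) {φ : ℂ × ℂ → ℂ}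
    (hφ : DifferentiableOn ℂ φ hartogsTriangle) (hb : ∀ p ∈ hartogsTriangle, ‖φ p‖ ≤ 1)
    {g : HardySpace} (hg : g ∈ multiples θ) : mulOp φ hφ hb g ∈ multiples θ := by
  obtain ⟨f, hf⟩ := hg
  refine ⟨mulOp φ hφ hb f, fun p hp => ?_⟩
  change φ p * g p = θ p * (φ p * f p)
  rw [hf p hp, mul_left_comm]

theorem adjoint_mem_orthogonal {S : Submodule ℂ HardySpace} {T : HardySpace →L[ℂ] HardySpace}
    (hT : ∀ g ∈ S, T g ∈ S) {f : HardySpace} (hf : f ∈ Sᗮ) :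
    ContinuousLinearMap.adjoint T f ∈ Sᗮ := by
  intro g hg
  rw [ContinuousLinearMap.adjoint_inner_right]
  exact hf _ (hT g hg)

/-- The quotient module `H² ⊖ θ H²`. -/
def quotientModule (θ : ℂ × ℂ → ℂ) : QuotientModule where
  toSubmodule := (multiples θ)ᗮ
  isClosed := Submodule.isClosed_orthogonal _
  adjoint_Mz_mem _ hf := adjoint_mem_orthogonal (fun _ hg => mulOp_mem_multiples θ _ _ hg) hf
  adjoint_Mw_mem _ hf := adjoint_mem_orthogonal (fun _ hg => mulOp_mem_multiples θ _ _ hg) hf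

/-- `θ` is an inner function on the unit disc (its values outside the disc are irrelevant):
holomorphic, bounded by one, with radial limits of modulus one almost everywhere on the circle. -/
structure IsInner (θ : ℂ → ℂ) : Prop where
  differentiableOn : DifferentiableOn ℂ θ (Metric.ball 0 1)
  norm_le_one : ∀ z ∈ Metric.ball (0 : ℂ) 1, ‖θ z‖ ≤ 1
  radial_limit : ∀ᵐ t : ℝ, ∃ ζ : ℂ, ‖ζ‖ = 1 ∧
    Tendsto (fun r : ℝ => θ (r * exp (t * I))) (𝓝[<] 1) (𝓝 ζ)

end Hartogs

end

/-!
In the coordinates `(u, w) = (z / w, w)` the Hardy space of the Hartogs triangle is the Hardy space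
of the bidisc, up to the weight `w⁻¹`: the functions `u ^ m * w ^ n / w` form a Hilbert basis. There
`M_z = M_u M_w`, the multiplications `A` by `θ₁ u` and `B` by `θ₂ w` act on separate tensor factors,
and the quotient module is the kernel of `(A B)*`.

Write `e = w⁻¹`, which both `M_u*` and `M_w*` annihilate. Testing the doubly commuting identity on
`M_u* A e` gives `M_u* M_u* A e = 0`, so `θ₁` is affine, hence constant or a rotation. Testing it on
`M_u M_w* B e` gives `(1 - |θ₂ 0|²) (θ₂ - θ₂ 0) = b w (1 - k conj (θ₂ 0) θ₂)` for some `b`, where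
`k = 1` if `θ₁` is constant and `k = 0` if it is a rotation; so `θ₂` is a Blaschke factor in the
first case and affine in the second. Conversely, in each of the four cases either `M_z*` vanishes on
the quotient module or the compression of `M_w` is a scalar.
-/

namespace Hartogs

open Complex MeasureTheory Set Filter Topology ComplexConjugate

section InnerFunctions

variable {θ φ ψ : ℂ → ℂ}

/-- `θ` is constant on the unit disc. -/
def IsConstOnDisc (θ : ℂ → ℂ) : Prop :=
  ∃ c : ℂ, ∀ z ∈ Metric.ball (0 : ℂ) 1, θ z = c

/-- `θ` is a rotation of the unit disc about the origin. -/
def IsRotation (θ : ℂ → ℂ) : Prop :=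
  ∃ c : ℂ, ‖c‖ = 1 ∧ ∀ z ∈ Metric.ball (0 : ℂ) 1, θ z = c * z

/-- `θ` is a Blaschke factor: a unimodular multiple of the automorphism of the unit disc sending `b`
to `0`. -/
def IsBlaschkeFactor (θ : ℂ → ℂ) : Prop :=
  ∃ b ∈ Metric.ball (0 : ℂ) 1, ∃ c : ℂ, ‖c‖ = 1 ∧
    ∀ w ∈ Metric.ball (0 : ℂ) 1, θ w = c * ((w - b) / (1 - conj b * w))

theorem IsRotation.exists_ne_zero (h : IsRotation θ) :
    ∃ c : ℂ, c ≠ 0 ∧ ∀ z ∈ Metric.ball (0 : ℂ) 1, θ z = c * z := by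
  obtain ⟨c, hc, hθ⟩ := h
  exact ⟨c, norm_ne_zero_iff.1 (by rw [hc]; exact one_ne_zero), hθ⟩

theorem tendsto_ofReal_mul_exp (t : ℝ) :
    Tendsto (fun r : ℝ => (r : ℂ) * exp (t * I)) (𝓝[<] 1)
      (𝓝[Metric.ball 0 1] exp (t * I)) := by
  refine tendsto_nhdsWithin_iff.2 ⟨?_, ?_⟩
  · have h : Continuous fun r : ℝ => (r : ℂ) * exp (t * I) := by fun_prop
    simpa using (h.tendsto 1).mono_left nhdsWithin_le_nhds
  · filter_upwards [Ioo_mem_nhdsLT one_pos] with r hr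
    simpa [norm_exp_ofReal_mul_I, abs_of_pos hr.1] using hr.2

theorem isInner_id : IsInner id where
  differentiableOn := differentiableOn_id
  norm_le_one _ hz := (mem_ball_zero_iff.1 hz).le
  radial_limit := .of_forall fun t =>
    ⟨_, norm_exp_ofReal_mul_I t, (tendsto_ofReal_mul_exp t).mono_right nhdsWithin_le_nhds⟩

theorem isInner_one : IsInner 1 where
  differentiableOn := differentiableOn_const 1
  norm_le_one _ _ := norm_one.le
  radial_limit := .of_forall fun _ => ⟨1, norm_one, tendsto_const_nhds⟩

theorem IsInner.mul (hφ : IsInner φ) (hψ : IsInner ψ) : IsInner (φ * ψ) where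
  differentiableOn := hφ.differentiableOn.mul hψ.differentiableOn
  norm_le_one z hz := by
    rw [Pi.mul_apply, norm_mul]
    exact mul_le_one₀ (hφ.norm_le_one z hz) (norm_nonneg _) (hψ.norm_le_one z hz)
  radial_limit := by
    filter_upwards [hφ.radial_limit, hψ.radial_limit] with t ⟨ζ, hζ, hφt⟩ ⟨ξ, hξ, hψt⟩
    exact ⟨ζ * ξ, by rw [norm_mul, hζ, hξ, one_mul], hφt.mul hψt⟩

theorem IsInner.pow (hφ : IsInner φ) : ∀ n : ℕ, IsInner (φ ^ n)
  | 0 => by simpa using isInner_one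
  | n + 1 => by simpa only [pow_succ] using (hφ.pow n).mul hφ

theorem IsInner.ae_norm_tendsto_one (h : IsInner θ) :
    ∀ᵐ t : ℝ, Tendsto (fun r : ℝ => ‖θ (r * exp (t * I))‖) (𝓝[<] 1) (𝓝 1) := by
  filter_upwards [h.radial_limit] with t ⟨ζ, hζ, hθ⟩
  simpa only [hζ] using hθ.norm

theorem IsInner.norm_eq_one_of_eqOn (h : IsInner θ) {g : ℂ → ℂ} (hg : Continuous g)
    (hθ : EqOn θ g (Metric.ball 0 1)) (t : ℝ) : ‖g (exp (t * I))‖ = 1 := by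
  have hae : (fun t : ℝ => ‖g (exp (t * I))‖) =ᵐ[volume] fun _ => 1 := by
    filter_upwards [h.ae_norm_tendsto_one] with t ht
    have hgt := (hg.norm.tendsto _).comp
      ((tendsto_ofReal_mul_exp t).mono_right nhdsWithin_le_nhds)
    have hgθ : ∀ᶠ r : ℝ in 𝓝[<] 1, ‖g (r * exp (t * I))‖ = ‖θ (r * exp (t * I))‖ :=
      ((tendsto_ofReal_mul_exp t).eventually_mem self_mem_nhdsWithin).mono fun r hr => by
        rw [hθ hr]
    exact tendsto_nhds_unique hgt (ht.congr' (hgθ.mono fun _ => Eq.symm))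
  exact congrFun ((Continuous.ae_eq_iff_eq volume (by fun_prop) continuous_const).1 hae) t

theorem IsInner.norm_eq_one_of_const (h : IsInner θ) {c : ℂ}
    (hc : ∀ z ∈ Metric.ball (0 : ℂ) 1, θ z = c) : ‖c‖ = 1 :=
  h.norm_eq_one_of_eqOn (g := fun _ => c) continuous_const hc 0

theorem IsInner.exists_ne_zero_of_isConstOnDisc (h : IsInner θ) (hc : IsConstOnDisc θ) :
    ∃ c : ℂ, c ≠ 0 ∧ ∀ z ∈ Metric.ball (0 : ℂ) 1, θ z = c := by
  obtain ⟨c, hc⟩ := hc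
  exact ⟨c, norm_ne_zero_iff.1 (by rw [h.norm_eq_one_of_const hc]; exact one_ne_zero), hc⟩

theorem IsInner.isConstOnDisc_of_norm_apply_zero (h : IsInner θ) (h0 : ‖θ 0‖ = 1) :
    IsConstOnDisc θ :=
  ⟨θ 0, Complex.eqOn_of_isPreconnected_of_isMaxOn_norm (convex_ball 0 1).isPreconnected
    Metric.isOpen_ball h.differentiableOn (Metric.mem_ball_self one_pos)
    fun z hz => (h.norm_le_one z hz).trans h0.ge⟩

theorem IsInner.const_or_rotation_of_affine (h : IsInner θ) {a b : ℂ}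
    (hab : ∀ z ∈ Metric.ball (0 : ℂ) 1, θ z = a + b * z) : IsConstOnDisc θ ∨ IsRotation θ := by
  have hnorm (t : ℝ) : normSq (a + b * exp (t * I)) = 1 := by
    rw [normSq_eq_norm_sq, h.norm_eq_one_of_eqOn (g := fun z => a + b * z) (by fun_prop) hab,
      one_pow]
  have h_one := hnorm 0
  have h_neg := hnorm Real.pi
  have h_I := hnorm (Real.pi / 2)
  simp only [ofReal_zero, zero_mul, exp_zero, mul_one, exp_pi_mul_I, ofReal_div, ofReal_ofNat,
    exp_pi_div_two_mul_I, normSq_add, normSq_neg, normSq_I, map_mul, map_neg,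
    conj_I, mul_neg, neg_re, ← mul_assoc, mul_I_re, neg_neg] at h_one h_neg h_I
  have h_zero : a * conj b = 0 :=
    Complex.ext (by rw [zero_re]; linarith) (by rw [zero_im]; linarith)
  rcases mul_eq_zero.1 h_zero with ha | hb
  · refine .inr ⟨b, ?_, fun z hz => by rw [hab z hz, ha, zero_add]⟩
    simpa [ha] using h.norm_eq_one_of_eqOn (g := fun z => a + b * z) (by fun_prop) hab 0
  · rw [map_eq_zero] at hb
    exact .inl ⟨a, fun z hz => by rw [hab z hz, hb, zero_mul, add_zero]⟩

theorem one_sub_conj_mul_ne_zero {b w : ℂ} (hb : ‖b‖ < 1) (hw : ‖w‖ ≤ 1) :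
    1 - conj b * w ≠ 0 := by
  have hlt : ‖conj b * w‖ < 1 := by
    rw [norm_mul, RCLike.norm_conj]
    exact mul_lt_one_of_nonneg_of_lt_one_left (norm_nonneg b) hb hw
  intro h
  rw [← sub_eq_zero.1 h, norm_one] at hlt
  exact hlt.false

theorem one_sub_mul_conj_ne_zero {a : ℂ} (ha : ‖a‖ < 1) : 1 - a * conj a ≠ 0 := by
  rw [mul_comm]
  exact one_sub_conj_mul_ne_zero ha ha.le

theorem norm_sub_eq_norm_one_sub_conj_mul (a : ℂ) {ζ : ℂ} (hζ : ‖ζ‖ = 1) :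
    ‖ζ - a‖ = ‖1 - conj a * ζ‖ := by
  have hζζ : conj ζ * ζ = 1 := by rw [conj_mul', hζ, ofReal_one, one_pow]
  calc ‖ζ - a‖ = ‖conj (ζ - a) * ζ‖ := by rw [norm_mul, hζ, mul_one, RCLike.norm_conj]
    _ = ‖1 - conj a * ζ‖ := by rw [map_sub, sub_mul, hζζ]

/-- The hypothesis says that `l * w` is the image of `θ w` under the disc automorphism sending `a`
to `0`, which has unimodular values on the circle. -/
theorem IsInner.isBlaschkeFactor_of_sub_eq (h : IsInner θ) {a l : ℂ} (ha : ‖a‖ < 1)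
    (hθ : ∀ w ∈ Metric.ball (0 : ℂ) 1, θ w - a = l * w * (1 - conj a * θ w)) :
    IsBlaschkeFactor θ := by
  have hl : ‖l‖ = 1 := by
    obtain ⟨t, ζ, hζ, hlim⟩ := h.radial_limit.exists
    have hrad := tendsto_ofReal_mul_exp t
    have hid := hrad.mono_right nhdsWithin_le_nhds
    have heq : ζ - a = l * exp (t * I) * (1 - conj a * ζ) :=
      tendsto_nhds_unique (hlim.sub_const a) <|
        ((hid.const_mul l).mul ((hlim.const_mul _).const_sub 1)).congr' <|
          (hrad.eventually_mem self_mem_nhdsWithin).mono fun r hr => (hθ _ hr).symm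
    have hne := norm_ne_zero_iff.2 (one_sub_conj_mul_ne_zero ha hζ.le)
    have hnorm := congrArg norm heq
    rw [norm_sub_eq_norm_one_sub_conj_mul a hζ, norm_mul, norm_mul, norm_exp_ofReal_mul_I,
      mul_one] at hnorm
    exact (mul_eq_right₀ hne).1 hnorm.symm
  have hll : l * conj l = 1 := by rw [mul_conj', hl, ofReal_one, one_pow]
  have hb : ‖-(a * conj l)‖ < 1 := by rwa [norm_neg, norm_mul, RCLike.norm_conj, hl, mul_one]
  refine ⟨-(a * conj l), mem_ball_zero_iff.2 hb, l, hl, fun w hw => ?_⟩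
  have hne := one_sub_conj_mul_ne_zero hb (mem_ball_zero_iff.1 hw).le
  rw [← mul_div_assoc, eq_div_iff hne, map_neg, map_mul, conj_conj]
  linear_combination hθ w hw - a * hll

end InnerFunctions

section TaylorCoefficients

variable {φ : ℂ → ℂ}

/-- The `n`-th Taylor coefficient of `φ` at the origin. -/
noncomputable def taylorCoeff (φ : ℂ → ℂ) (n : ℕ) : ℂ := (n.factorial : ℂ)⁻¹ * iteratedDeriv n φ 0

theorem taylorCoeff_zero (φ : ℂ → ℂ) : taylorCoeff φ 0 = φ 0 := by
  rw [taylorCoeff, iteratedDeriv_zero, Nat.factorial_zero, Nat.cast_one, inv_one, one_mul]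

theorem hasSum_taylorCoeff (hφ : DifferentiableOn ℂ φ (Metric.ball 0 1)) {z : ℂ} (hz : ‖z‖ < 1) :
    HasSum (fun n => taylorCoeff φ n * z ^ n) (φ z) := by
  have h := hasSum_taylorSeries_on_ball hφ (mem_ball_zero_iff.2 hz)
  simpa [taylorCoeff, smul_eq_mul, mul_comm, mul_left_comm, mul_assoc] using h

theorem norm_taylorCoeff_le_one (hφ : DifferentiableOn ℂ φ (Metric.ball 0 1))
    (hb : ∀ z ∈ Metric.ball (0 : ℂ) 1, ‖φ z‖ ≤ 1) (n : ℕ) : ‖taylorCoeff φ n‖ ≤ 1 := by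
  have hcauchy : ∀ r ∈ Ioo (0 : ℝ) 1, ‖taylorCoeff φ n‖ * r ^ n ≤ 1 := fun r hr => by
    have hsub : Metric.closedBall (0 : ℂ) r ⊆ Metric.ball 0 1 :=
      Metric.closedBall_subset_ball hr.2
    have h := norm_iteratedDeriv_le_of_forall_mem_sphere_norm_le n hr.1
      (hφ.diffContOnCl_ball hsub) fun z hz => hb z (hsub (Metric.sphere_subset_closedBall hz))
    rw [mul_one, le_div_iff₀ (pow_pos hr.1 n)] at h
    rwa [taylorCoeff, norm_mul, norm_inv, Complex.norm_natCast, mul_assoc,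
      inv_mul_le_iff₀ (by positivity), mul_one]
  have hlim : Tendsto (fun r : ℝ => ‖taylorCoeff φ n‖ * r ^ n) (𝓝[<] 1) (𝓝 ‖taylorCoeff φ n‖) := by
    have hcont : Continuous fun r : ℝ => ‖taylorCoeff φ n‖ * r ^ n := by fun_prop
    simpa using (hcont.tendsto 1).mono_left nhdsWithin_le_nhds
  exact le_of_tendsto hlim (mem_of_superset (Ioo_mem_nhdsLT one_pos) hcauchy)

theorem taylorCoeff_id_pow (k i : ℕ) : taylorCoeff (id ^ k) i = if i = k then 1 else 0 := by
  rw [taylorCoeff, show (id ^ k : ℂ → ℂ) = (· ^ k) from rfl, iteratedDeriv_fun_pow_zero]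
  split_ifs with h
  · rw [h, inv_mul_cancel₀ (Nat.cast_ne_zero.2 k.factorial_ne_zero)]
  · rw [Nat.cast_zero, mul_zero]

end TaylorCoefficients

section MonomialBasis

open HardySpace

/-- The coefficient map as an isometry onto `ℓ²`. -/
noncomputable def coeffIsometry : HardySpace ≃ₗᵢ[ℂ] lp (fun _ : ℕ × ℕ => ℂ) 2 :=
  ⟨LinearEquiv.ofBijective coeffMap coeffMap_bijective, norm_coeffMap⟩

/-- The orthonormal basis of the functions `w⁻¹ (z / w) ^ i w ^ j`. -/
noncomputable def monomial : HilbertBasis (ℕ × ℕ) ℂ HardySpace := .ofRepr coeffIsometry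

theorem inner_monomial (p : ℕ × ℕ) (f : HardySpace) : inner ℂ (monomial p) f = hardyCoeff f p :=
  (monomial.repr_apply_apply f p).symm

theorem inner_monomial_monomial (p q : ℕ × ℕ) :
    inner ℂ (monomial p) (monomial q) = if p = q then 1 else 0 :=
  orthonormal_iff_ite.1 monomial.orthonormal p q

theorem ext_inner_monomial {f g : HardySpace}
    (h : ∀ p, inner ℂ (monomial p) f = inner ℂ (monomial p) g) : f = g :=
  coeffMap_bijective.1 <| lp.ext <| funext fun p => by
    rw [coeffMap_apply, coeffMap_apply, ← inner_monomial, ← inner_monomial, h]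

theorem norm_hardyCoeff_le (f : HardySpace) (p : ℕ × ℕ) : ‖hardyCoeff f p‖ ≤ ‖f‖ := by
  simpa only [norm_coeffMap, coeffMap_apply] using
    lp.norm_apply_le_norm two_ne_zero (coeffMap f) p

theorem eq_hartogsSeries (f : HardySpace) : f.toFun = hartogsSeries (hardyCoeff f) :=
  congrArg toFun <| show f = ofMem _ (hartogsSeries_mem (summable_hardyCoeff f.mem)) from
    coeffMap_bijective.1 <| lp.ext <| funext fun p =>
      (hardyCoeff_hartogsSeries (norm_hardyCoeff_le f) p).symm

theorem monomial_apply (p : ℕ × ℕ) {q : ℂ × ℂ} (hq : q ∈ hartogsTriangle) :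
    monomial p q = q.2⁻¹ * ((q.1 / q.2) ^ p.1 * q.2 ^ p.2) := by
  rw [eq_hartogsSeries, hartogsSeries, if_pos hq, bidiscSeries, tsum_eq_single p]
  · rw [← inner_monomial, inner_monomial_monomial, if_pos rfl, one_mul]
  · intro r hr
    rw [← inner_monomial, inner_monomial_monomial, if_neg hr, zero_mul]

theorem inner_monomial_eq_of_hasSum {f : HardySpace} {A : ℕ × ℕ → ℂ} {B : ℝ} (hA : ∀ p, ‖A p‖ ≤ B)
    (h : ∀ q ∈ hartogsTriangle,
      HasSum (fun p : ℕ × ℕ => A p * ((q.1 / q.2) ^ p.1 * q.2 ^ p.2)) (q.2 * f q)) (p : ℕ × ℕ) :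
    inner ℂ (monomial p) f = A p := by
  have hf : f.toFun = hartogsSeries A := by
    ext q
    by_cases hq : q ∈ hartogsTriangle
    · rw [hartogsSeries, if_pos hq, bidiscSeries, (h q hq).tsum_eq,
        inv_mul_cancel_left₀ (snd_ne_zero hq)]
    · rw [hartogsSeries, if_neg hq, f.mem.2.2 q hq]
  rw [inner_monomial, hf, hardyCoeff_hartogsSeries hA]

theorem hardyMean_le_norm_sq (f : HardySpace) {s t : ℝ} (hs : s ∈ Ioo (0 : ℝ) 1)
    (ht : t ∈ Ioo (0 : ℝ) 1) : hardyMean f s t ≤ ‖f‖ ^ 2 := by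
  rw [HardySpace.norm_def, iSup_hardyMean f.mem,
    Real.sq_sqrt (tsum_nonneg fun _ => by positivity)]
  exact hardyMean_le_tsum f.mem hs ht

end MonomialBasis

section TensorMul

variable {φ ψ φ' ψ' : ℂ → ℂ}

theorem differentiableOn_div :
    DifferentiableOn ℂ (fun p : ℂ × ℂ => p.1 / p.2) hartogsTriangle := fun p hp => by
  simp only [div_eq_mul_inv]
  exact (differentiableAt_fst.mul
    (differentiableAt_snd.inv (snd_ne_zero hp))).differentiableWithinAt

/-- Multiplication by `φ (z / w) * ψ w`. In the coordinates `(z / w, w)`, which identify `H²` with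
the Hardy space of the bidisc, this is the tensor product of the multiplications by `φ` and `ψ`. -/
noncomputable def tensorMul (hφ : IsInner φ) (hψ : IsInner ψ) : HardySpace →L[ℂ] HardySpace :=
  mulOp (fun p => φ (p.1 / p.2) * ψ p.2)
    ((hφ.differentiableOn.comp differentiableOn_div
      fun _ hp => mem_ball_zero_iff.2 (norm_div_lt_one hp)).mul
    (hψ.differentiableOn.comp differentiableOn_snd fun _ hp => mem_ball_zero_iff.2 hp.2))
    fun p hp => by
      rw [norm_mul]
      exact mul_le_one₀ (hφ.norm_le_one _ (mem_ball_zero_iff.2 (norm_div_lt_one hp)))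
        (norm_nonneg _) (hψ.norm_le_one _ (mem_ball_zero_iff.2 hp.2))

/-- Multiplication by `φ (z / w)`. -/
noncomputable abbrev fstMul (hφ : IsInner φ) : HardySpace →L[ℂ] HardySpace :=
  tensorMul hφ isInner_one

/-- Multiplication by `ψ w`. -/
noncomputable abbrev sndMul (hψ : IsInner ψ) : HardySpace →L[ℂ] HardySpace :=
  tensorMul isInner_one hψ

/-- Multiplication by `z / w`. -/
noncomputable abbrev Mu : HardySpace →L[ℂ] HardySpace := fstMul isInner_id

theorem tensorMul_apply (hφ : IsInner φ) (hψ : IsInner ψ) (f : HardySpace) (p : ℂ × ℂ) :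
    tensorMul hφ hψ f p = φ (p.1 / p.2) * ψ p.2 * f p := rfl

theorem Mw_apply (f : HardySpace) (p : ℂ × ℂ) : Mw f p = p.2 * f p := rfl

theorem Mw_eq_sndMul : Mw = sndMul isInner_id :=
  ContinuousLinearMap.ext fun f => HardySpace.ext fun p _ => by
    rw [Mw_apply, tensorMul_apply, Pi.one_apply, one_mul, id]

theorem Mz_apply_eq (f : HardySpace) : Mz f = Mu (Mw f) := HardySpace.ext fun p hp => by
  change p.1 * f p = p.1 / p.2 * 1 * (p.2 * f p)
  rw [mul_one, ← mul_assoc, div_mul_cancel₀ _ (snd_ne_zero hp)]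

theorem tensorMul_eq_fstMul_sndMul (hφ : IsInner φ) (hψ : IsInner ψ) (f : HardySpace) :
    tensorMul hφ hψ f = fstMul hφ (sndMul hψ f) :=
  HardySpace.ext fun p _ => by
    simp only [tensorMul_apply, Pi.one_apply]
    ring

theorem tensorMul_comm (hφ : IsInner φ) (hψ : IsInner ψ) (hφ' : IsInner φ')
    (hψ' : IsInner ψ') (f : HardySpace) :
    tensorMul hφ hψ (tensorMul hφ' hψ' f) = tensorMul hφ' hψ' (tensorMul hφ hψ f) :=
  HardySpace.ext fun p _ => by
    simp only [tensorMul_apply]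
    ring

theorem tensorMul_monomial (hφ : IsInner φ) (hψ : IsInner ψ) (p : ℕ × ℕ) :
    tensorMul hφ hψ (monomial p) =
      tensorMul (hφ.mul (isInner_id.pow p.1)) (hψ.mul (isInner_id.pow p.2)) (monomial 0) :=
  HardySpace.ext fun q hq => by
    simp only [tensorMul_apply, monomial_apply _ hq, Pi.mul_apply, Pi.pow_apply, id, Prod.fst_zero,
      Prod.snd_zero, pow_zero]
    ring

end TensorMul

section Isometry

variable {φ ψ : ℂ → ℂ}

theorem hardyMean_tensorMul_monomial_zero (hφ : IsInner φ) (hψ : IsInner ψ) {s t : ℝ}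
    (hs : s ∈ Ioo (0 : ℝ) 1) (ht : t ∈ Ioo (0 : ℝ) 1) :
    hardyMean (tensorMul hφ hψ (monomial 0)) s t =
      1 / (4 * Real.pi ^ 2) * ∫ a in (0 : ℝ)..(2 * Real.pi), ∫ b in (0 : ℝ)..(2 * Real.pi),
        ‖φ (s * exp ((a - b : ℝ) * I))‖ ^ 2 * ‖ψ (t * exp (b * I))‖ ^ 2 * s := by
  rw [hardyMean]
  congr! 5 with a b
  have ht0 : (t : ℂ) ≠ 0 := ofReal_ne_zero.2 ht.1.ne'
  have hmem := mem_hartogsTriangle_polar (mul_pos hs.1 ht.1).le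
    (mul_lt_of_lt_one_left ht.1 hs.2) ht.2 a b
  rw [ofReal_mul] at hmem
  have hdiv : (s * t * exp (a * I)) / (t * exp (b * I)) = s * exp ((a - b : ℝ) * I) := by
    rw [ofReal_sub, sub_mul, exp_sub]
    field_simp
  rw [tensorMul_apply, monomial_apply _ hmem, hdiv]
  simp only [Prod.fst_zero, Prod.snd_zero, pow_zero, mul_one, norm_mul, norm_inv, norm_real,
    norm_exp_ofReal_mul_I, Real.norm_of_nonneg ht.1.le]
  field_simp [ht.1.ne']

theorem IsInner.continuous_circle (h : IsInner φ) {r : ℝ} (hr : r ∈ Ioo (0 : ℝ) 1) :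
    Continuous fun t : ℝ => φ (r * exp (t * I)) :=
  h.differentiableOn.continuousOn.comp_continuous (by fun_prop) fun t => by
    simpa [norm_exp_ofReal_mul_I, abs_of_pos hr.1] using hr.2

theorem IsInner.norm_sq_circle_le_one (h : IsInner φ) {r : ℝ} (hr : r ∈ Ioo (0 : ℝ) 1) (t : ℝ) :
    ‖φ (r * exp (t * I))‖ ^ 2 ≤ 1 :=
  pow_le_one₀ (norm_nonneg _) <| h.norm_le_one _ <| by
    simpa [norm_exp_ofReal_mul_I, abs_of_pos hr.1] using hr.2

theorem norm_circle_integrand_le_one (hφ : IsInner φ) (hψ : IsInner ψ) {s : ℝ}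
    (hs : s ∈ Ioo (0 : ℝ) 1) (a b : ℝ) :
    ‖‖φ (s * exp (a * I))‖ ^ 2 * ‖ψ (s * exp (b * I))‖ ^ 2 * s‖ ≤ 1 := by
  rw [Real.norm_of_nonneg (by have := hs.1; positivity)]
  exact mul_le_one₀ (mul_le_one₀ (hφ.norm_sq_circle_le_one hs a) (by positivity)
    (hψ.norm_sq_circle_le_one hs b)) hs.1.le hs.2.le

theorem tendsto_integral_norm_sq_mul (hφ : IsInner φ) (hψ : IsInner ψ) (a : ℝ) :
    Tendsto (fun s : ℝ => ∫ b in (0 : ℝ)..(2 * Real.pi),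
      ‖φ (s * exp ((a - b : ℝ) * I))‖ ^ 2 * ‖ψ (s * exp (b * I))‖ ^ 2 * s)
      (𝓝[<] 1) (𝓝 (2 * Real.pi)) := by
  have hIoo : ∀ᶠ s : ℝ in 𝓝[<] 1, s ∈ Ioo (0 : ℝ) 1 := Ioo_mem_nhdsLT one_pos
  have hlim := intervalIntegral.tendsto_integral_filter_of_dominated_convergence (μ := volume)
    (a := 0) (b := 2 * Real.pi) (l := 𝓝[<] (1 : ℝ)) (f := fun _ => (1 : ℝ))
    (F := fun s b => ‖φ (s * exp ((a - b : ℝ) * I))‖ ^ 2 * ‖ψ (s * exp (b * I))‖ ^ 2 * s)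
    (fun _ => 1) ?_ ?_ intervalIntegrable_const ?_
  · simpa using hlim
  · filter_upwards [hIoo] with s hs
    have h1 := (hφ.continuous_circle hs).comp (continuous_sub_left a)
    have h2 := hψ.continuous_circle hs
    exact (((h1.norm.pow 2).mul (h2.norm.pow 2)).mul_const s).aestronglyMeasurable
  · filter_upwards [hIoo] with s hs
    exact .of_forall fun b _ => norm_circle_integrand_le_one hφ hψ hs (a - b) b
  · filter_upwards [(volume.measurePreserving_sub_left a).quasiMeasurePreserving.ae
      hφ.ae_norm_tendsto_one, hψ.ae_norm_tendsto_one] with b h1 h2 _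
    have hs : Tendsto (fun s : ℝ => s) (𝓝[<] 1) (𝓝 1) := nhdsWithin_le_nhds
    simpa using ((h1.pow 2).mul (h2.pow 2)).mul hs

theorem tendsto_hardyMean_tensorMul_monomial_zero (hφ : IsInner φ) (hψ : IsInner ψ) :
    Tendsto (fun s : ℝ => hardyMean (tensorMul hφ hψ (monomial 0)) s s) (𝓝[<] 1) (𝓝 1) := by
  have hIoo : ∀ᶠ s : ℝ in 𝓝[<] 1, s ∈ Ioo (0 : ℝ) 1 := Ioo_mem_nhdsLT one_pos
  have hlim := intervalIntegral.tendsto_integral_filter_of_dominated_convergence (μ := volume)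
    (a := 0) (b := 2 * Real.pi) (l := 𝓝[<] (1 : ℝ)) (f := fun _ => 2 * Real.pi)
    (F := fun s a => ∫ b in (0 : ℝ)..(2 * Real.pi),
      ‖φ (s * exp ((a - b : ℝ) * I))‖ ^ 2 * ‖ψ (s * exp (b * I))‖ ^ 2 * s)
    (fun _ => 2 * Real.pi) ?_ ?_ intervalIntegrable_const
    (.of_forall fun a _ => tendsto_integral_norm_sq_mul hφ hψ a)
  · have hconst : 1 / (4 * Real.pi ^ 2) * ∫ _ in (0 : ℝ)..(2 * Real.pi), 2 * Real.pi = 1 := by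
      rw [intervalIntegral.integral_const, smul_eq_mul]
      field_simp
      ring
    have hlim' := hlim.const_mul (1 / (4 * Real.pi ^ 2))
    rw [hconst] at hlim'
    exact hlim'.congr' <|
      hIoo.mono fun s hs => (hardyMean_tensorMul_monomial_zero hφ hψ hs hs).symm
  · filter_upwards [hIoo] with s hs
    refine (intervalIntegral.continuous_parametric_intervalIntegral_of_continuous' ?_
      _ _).aestronglyMeasurable
    have h1 := (hφ.continuous_circle hs).comp
      (by fun_prop : Continuous fun x : ℝ × ℝ => x.1 - x.2)
    have h2 := (hψ.continuous_circle hs).comp (by fun_prop : Continuous fun x : ℝ × ℝ => x.2)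
    exact ((h1.norm.pow 2).mul (h2.norm.pow 2)).mul_const s
  · filter_upwards [hIoo] with s hs
    refine .of_forall fun a _ => ?_
    have h := intervalIntegral.norm_integral_le_of_norm_le_const (a := 0) (b := 2 * Real.pi)
      fun b _ => norm_circle_integrand_le_one hφ hψ hs (a - b) b
    simpa [abs_of_pos Real.pi_pos] using h

theorem norm_tensorMul_le (hφ : IsInner φ) (hψ : IsInner ψ) : ‖tensorMul hφ hψ‖ ≤ 1 := by
  rw [tensorMul, mulOp]
  exact LinearMap.mkContinuous_norm_le _ zero_le_one _

theorem norm_tensorMul_monomial_zero (hφ : IsInner φ) (hψ : IsInner ψ) :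
    ‖tensorMul hφ hψ (monomial 0)‖ = 1 := by
  refine le_antisymm ?_ ?_
  · simpa [monomial.orthonormal.1] using
      (tensorMul hφ hψ).le_of_opNorm_le (norm_tensorMul_le hφ hψ) (monomial 0)
  · refine (one_le_sq_iff₀ (norm_nonneg _)).1 <|
      le_of_tendsto (tendsto_hardyMean_tensorMul_monomial_zero hφ hψ) ?_
    filter_upwards [Ioo_mem_nhdsLT one_pos] with s hs using hardyMean_le_norm_sq _ hs hs

theorem adjoint_apply_apply_of_norm_eq {𝕜 E F : Type*} [RCLike 𝕜]
    [NormedAddCommGroup E] [InnerProductSpace 𝕜 E] [CompleteSpace E]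
    [NormedAddCommGroup F] [InnerProductSpace 𝕜 F] [CompleteSpace F]
    {T : E →L[𝕜] F} (hT : ‖T‖ ≤ 1) {x : E} (hx : ‖T x‖ = ‖x‖) :
    T.adjoint (T x) = x := by
  have hle : ‖T.adjoint (T x)‖ ≤ ‖x‖ := by
    simpa [hx] using T.adjoint.le_of_opNorm_le
      ((ContinuousLinearMap.adjoint.norm_map T).trans_le hT) (T x)
  have hre : RCLike.re (inner 𝕜 (T.adjoint (T x)) x) = ‖x‖ ^ 2 := by
    rw [← hx]
    exact (T.apply_norm_sq_eq_inner_adjoint_left x).symm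
  have hsq : ‖T.adjoint (T x) - x‖ ^ 2 ≤ 0 := by
    rw [norm_sub_sq (𝕜 := 𝕜), hre]
    linarith [pow_le_pow_left₀ (norm_nonneg _) hle 2]
  exact sub_eq_zero.1 (norm_eq_zero.1 (pow_eq_zero_iff two_ne_zero |>.1
    (le_antisymm hsq (sq_nonneg _))))

theorem adjoint_tensorMul_tensorMul (hφ : IsInner φ) (hψ : IsInner ψ) (f : HardySpace) :
    (tensorMul hφ hψ).adjoint (tensorMul hφ hψ f) = f := by
  have h : (tensorMul hφ hψ).adjoint ∘L tensorMul hφ hψ = .id ℂ HardySpace := by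
    refine ContinuousLinearMap.ext_on
      (Submodule.dense_iff_topologicalClosure_eq_top.2 monomial.dense_span) ?_
    rintro _ ⟨p, rfl⟩
    refine adjoint_apply_apply_of_norm_eq (norm_tensorMul_le hφ hψ) ?_
    rw [tensorMul_monomial, norm_tensorMul_monomial_zero, monomial.orthonormal.1]
  exact congrArg (· f) h

end Isometry

section DoubleCommutation

variable {φ ψ : ℂ → ℂ}

theorem IsInner.norm_taylorCoeff_le_one (h : IsInner φ) (n : ℕ) : ‖taylorCoeff φ n‖ ≤ 1 :=
  Hartogs.norm_taylorCoeff_le_one h.differentiableOn h.norm_le_one n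

theorem inner_monomial_tensorMul_monomial_zero (hφ : IsInner φ) (hψ : IsInner ψ) (p : ℕ × ℕ) :
    inner ℂ (monomial p) (tensorMul hφ hψ (monomial 0)) =
      taylorCoeff φ p.1 * taylorCoeff ψ p.2 := by
  refine inner_monomial_eq_of_hasSum (A := fun p => taylorCoeff φ p.1 * taylorCoeff ψ p.2)
    (B := 1) (fun p => ?_) (fun q hq => ?_) p
  · rw [norm_mul]
    exact mul_le_one₀ (hφ.norm_taylorCoeff_le_one _) (norm_nonneg _)
      (hψ.norm_taylorCoeff_le_one _)
  · have h1 := hasSum_taylorCoeff hφ.differentiableOn (norm_div_lt_one hq)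
    have h2 := hasSum_taylorCoeff hψ.differentiableOn hq.2
    have hfq : q.2 * tensorMul hφ hψ (monomial 0) q = φ (q.1 / q.2) * ψ q.2 := by
      rw [tensorMul_apply, monomial_apply _ hq, Prod.fst_zero, Prod.snd_zero, pow_zero, pow_zero,
        mul_one, mul_one, mul_left_comm, mul_inv_cancel₀ (snd_ne_zero hq), mul_one]
    have hs := summable_mul_of_summable_norm h1.summable.norm h2.summable.norm
    have hsum := HasSum.mul h1 h2 hs
    simpa only [hfq, mul_mul_mul_comm (taylorCoeff φ _)] using hsum

theorem inner_monomial_fstMul_monomial (hφ : IsInner φ) (p q : ℕ × ℕ) :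
    inner ℂ (monomial p) (fstMul hφ (monomial q)) =
      if p.2 = q.2 then taylorCoeff (φ * id ^ q.1) p.1 else 0 := by
  rw [tensorMul_monomial, inner_monomial_tensorMul_monomial_zero, one_mul, taylorCoeff_id_pow,
    mul_ite, mul_one, mul_zero]

theorem inner_monomial_sndMul_monomial (hψ : IsInner ψ) (p q : ℕ × ℕ) :
    inner ℂ (monomial p) (sndMul hψ (monomial q)) =
      if p.1 = q.1 then taylorCoeff (ψ * id ^ q.2) p.2 else 0 := by
  rw [tensorMul_monomial, inner_monomial_tensorMul_monomial_zero, one_mul, taylorCoeff_id_pow,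
    ite_mul, one_mul, zero_mul]

theorem inner_fstMul_monomial_monomial (hφ : IsInner φ) (p q : ℕ × ℕ) :
    inner ℂ (fstMul hφ (monomial p)) (monomial q) =
      if p.2 = q.2 then conj (taylorCoeff (φ * id ^ p.1) q.1) else 0 := by
  rw [← inner_conj_symm, inner_monomial_fstMul_monomial, apply_ite conj, map_zero]
  simp only [eq_comm]

theorem inner_fstMul_monomial_sndMul_monomial (hφ : IsInner φ) (hψ : IsInner ψ) (p q : ℕ × ℕ) :
    inner ℂ (fstMul hφ (monomial p)) (sndMul hψ (monomial q)) =
      conj (taylorCoeff (φ * id ^ p.1) q.1) * taylorCoeff (ψ * id ^ q.2) p.2 := by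
  rw [← monomial.tsum_inner_mul_inner, tsum_eq_single (q.1, p.2)]
  · rw [inner_fstMul_monomial_monomial, inner_monomial_sndMul_monomial, if_pos rfl, if_pos rfl]
  · intro r hr
    rw [inner_fstMul_monomial_monomial, inner_monomial_sndMul_monomial]
    grind

theorem inner_adjoint_sndMul_monomial_adjoint_fstMul_monomial (hφ : IsInner φ) (hψ : IsInner ψ)
    (p q : ℕ × ℕ) :
    inner ℂ ((sndMul hψ).adjoint (monomial p)) ((fstMul hφ).adjoint (monomial q)) =
      conj (taylorCoeff (φ * id ^ p.1) q.1) * taylorCoeff (ψ * id ^ q.2) p.2 := by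
  rw [← monomial.tsum_inner_mul_inner, tsum_eq_single (p.1, q.2)]
  · rw [ContinuousLinearMap.adjoint_inner_left, ContinuousLinearMap.adjoint_inner_right,
      inner_fstMul_monomial_monomial, inner_monomial_sndMul_monomial, if_pos rfl, if_pos rfl,
      mul_comm]
  · intro r hr
    rw [ContinuousLinearMap.adjoint_inner_left, ContinuousLinearMap.adjoint_inner_right,
      inner_fstMul_monomial_monomial, inner_monomial_sndMul_monomial]
    grind

theorem adjoint_fstMul_sndMul (hφ : IsInner φ) (hψ : IsInner ψ) (f : HardySpace) :
    (fstMul hφ).adjoint (sndMul hψ f) = sndMul hψ ((fstMul hφ).adjoint f) := by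
  suffices h : (fstMul hφ).adjoint ∘L sndMul hψ = sndMul hψ ∘L (fstMul hφ).adjoint from
    congrArg (· f) h
  refine ContinuousLinearMap.ext_on
    (Submodule.dense_iff_topologicalClosure_eq_top.2 monomial.dense_span) ?_
  rintro _ ⟨q, rfl⟩
  refine ext_inner_monomial fun p => ?_
  rw [ContinuousLinearMap.comp_apply, ContinuousLinearMap.comp_apply,
    ContinuousLinearMap.adjoint_inner_right,
    ← ContinuousLinearMap.adjoint_inner_left (sndMul hψ) _ (monomial p),
    inner_fstMul_monomial_sndMul_monomial, inner_adjoint_sndMul_monomial_adjoint_fstMul_monomial]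

theorem adjoint_sndMul_fstMul (hφ : IsInner φ) (hψ : IsInner ψ) (f : HardySpace) :
    (sndMul hψ).adjoint (fstMul hφ f) = fstMul hφ ((sndMul hψ).adjoint f) :=
  ext_inner_left ℂ fun g => by
    rw [ContinuousLinearMap.adjoint_inner_right, ← ContinuousLinearMap.adjoint_inner_left,
      adjoint_fstMul_sndMul, ← ContinuousLinearMap.adjoint_inner_right,
      ContinuousLinearMap.adjoint_inner_left]

end DoubleCommutation

section BackwardShifts

variable {φ ψ φ' ψ' : ℂ → ℂ}

theorem adjoint_tensorMul_comm (hφ : IsInner φ) (hψ : IsInner ψ) (hφ' : IsInner φ')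
    (hψ' : IsInner ψ') (f : HardySpace) :
    (tensorMul hφ hψ).adjoint ((tensorMul hφ' hψ').adjoint f) =
      (tensorMul hφ' hψ').adjoint ((tensorMul hφ hψ).adjoint f) :=
  ext_inner_left ℂ fun g => by
    simp only [ContinuousLinearMap.adjoint_inner_right, tensorMul_comm hφ hψ hφ' hψ']

theorem Mu_monomial (i j : ℕ) : Mu (monomial (i, j)) = monomial (i + 1, j) :=
  HardySpace.ext fun p hp => by
    rw [tensorMul_apply, monomial_apply _ hp, monomial_apply _ hp, Pi.one_apply, id, pow_succ']
    ring

theorem Mw_monomial (i j : ℕ) : Mw (monomial (i, j)) = monomial (i, j + 1) :=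
  HardySpace.ext fun p hp => by
    rw [Mw_apply, monomial_apply _ hp, monomial_apply _ hp, pow_succ']
    ring

theorem adjoint_Mu_monomial_zero : Mu.adjoint (monomial 0) = 0 :=
  ext_inner_monomial fun ⟨i, j⟩ => by
    rw [ContinuousLinearMap.adjoint_inner_right, Mu_monomial, inner_monomial_monomial,
      inner_zero_right, if_neg (by simp)]

theorem adjoint_Mw_monomial_zero : Mw.adjoint (monomial 0) = 0 :=
  ext_inner_monomial fun ⟨i, j⟩ => by
    rw [ContinuousLinearMap.adjoint_inner_right, Mw_monomial, inner_monomial_monomial,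
      inner_zero_right, if_neg (by simp)]

theorem eq_smul_monomial_zero {f : HardySpace} (hu : Mu.adjoint f = 0) (hw : Mw.adjoint f = 0) :
    f = (inner ℂ (monomial 0) f : ℂ) • monomial 0 := by
  refine ext_inner_monomial fun p => ?_
  rw [inner_smul_right, inner_monomial_monomial]
  obtain ⟨_ | i, _ | j⟩ := p
  · simp only [Prod.mk_zero_zero, if_true, mul_one]
  · rw [← Mw_monomial, ← ContinuousLinearMap.adjoint_inner_right, hw, inner_zero_right,
      if_neg (by simp), mul_zero]
  all_goals rw [← Mu_monomial, ← ContinuousLinearMap.adjoint_inner_right, hu, inner_zero_right,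
      if_neg (by simp), mul_zero]

theorem adjoint_Mu_Mu (f : HardySpace) : Mu.adjoint (Mu f) = f :=
  adjoint_tensorMul_tensorMul _ _ f

theorem adjoint_Mw_Mw (f : HardySpace) : Mw.adjoint (Mw f) = f := by
  rw [Mw_eq_sndMul, adjoint_tensorMul_tensorMul]

theorem adjoint_Mu_Mw (f : HardySpace) : Mu.adjoint (Mw f) = Mw (Mu.adjoint f) := by
  rw [Mw_eq_sndMul, adjoint_fstMul_sndMul]

theorem adjoint_Mw_Mu (f : HardySpace) : Mw.adjoint (Mu f) = Mu (Mw.adjoint f) := by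
  rw [Mw_eq_sndMul, adjoint_sndMul_fstMul]

theorem adjoint_Mu_adjoint_Mw (f : HardySpace) :
    Mu.adjoint (Mw.adjoint f) = Mw.adjoint (Mu.adjoint f) := by
  rw [Mw_eq_sndMul, adjoint_tensorMul_comm]

theorem Mw_adjoint_Mw_of_adjoint_Mu_eq_zero {f : HardySpace} (hf : Mu.adjoint f = 0) :
    Mw (Mw.adjoint f) = f - (inner ℂ (monomial 0) f : ℂ) • monomial 0 := by
  have h := eq_smul_monomial_zero (f := f - Mw (Mw.adjoint f))
    (by rw [map_sub, adjoint_Mu_Mw, adjoint_Mu_adjoint_Mw, hf, map_zero, map_zero, sub_zero])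
    (by rw [map_sub, adjoint_Mw_Mw, sub_self])
  rw [inner_sub_right, ← ContinuousLinearMap.adjoint_inner_left, adjoint_Mw_monomial_zero,
    inner_zero_left, sub_zero] at h
  rw [← h, sub_sub_cancel]

theorem Mu_adjoint_Mu_of_adjoint_Mw_eq_zero {f : HardySpace} (hf : Mw.adjoint f = 0) :
    Mu (Mu.adjoint f) = f - (inner ℂ (monomial 0) f : ℂ) • monomial 0 := by
  have h := eq_smul_monomial_zero (f := f - Mu (Mu.adjoint f))
    (by rw [map_sub, adjoint_Mu_Mu, sub_self])
    (by rw [map_sub, adjoint_Mw_Mu, ← adjoint_Mu_adjoint_Mw, hf, map_zero, map_zero, sub_zero])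
  rw [inner_sub_right, ← ContinuousLinearMap.adjoint_inner_left, adjoint_Mu_monomial_zero,
    inner_zero_left, sub_zero] at h
  rw [← h, sub_sub_cancel]

end BackwardShifts

namespace QuotientModule

variable (Q : QuotientModule)

theorem coe_adjoint_compression_Mz (f : Q.toSubmodule) :
    ((Q.compression Mz).adjoint f : HardySpace) = Mz.adjoint f := by
  rw [compression, ContinuousLinearMap.adjoint_comp, ContinuousLinearMap.adjoint_comp,
    Submodule.adjoint_subtypeL, Submodule.adjoint_orthogonalProjectionOnto]
  exact congrArg Subtype.val <| Submodule.orthogonalProjectionOnto_mem_subspace_eq_self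
    (⟨_, Q.adjoint_Mz_mem f f.2⟩ : Q.toSubmodule)

variable {Q}

theorem isDoublyCommuting_iff : Q.IsDoublyCommuting ↔ ∀ f ∈ Q.toSubmodule,
    Mz.adjoint (Q.toSubmodule.starProjection (Mw f)) =
      Q.toSubmodule.starProjection (Mw (Mz.adjoint f)) := by
  rw [IsDoublyCommuting, sub_eq_zero, ContinuousLinearMap.ext_iff, Subtype.forall]
  refine forall₂_congr fun f hf => ?_
  rw [← Subtype.coe_inj, ContinuousLinearMap.comp_apply, ContinuousLinearMap.comp_apply,
    coe_adjoint_compression_Mz, ← coe_adjoint_compression_Mz Q ⟨f, hf⟩]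
  rfl

theorem isDoublyCommuting_of_adjoint_Mz_eq_zero (h : ∀ f ∈ Q.toSubmodule, Mz.adjoint f = 0) :
    Q.IsDoublyCommuting :=
  isDoublyCommuting_iff.2 fun f hf => by
    rw [h _ (Submodule.starProjection_apply_mem _ _), h f hf, map_zero, map_zero]

theorem isDoublyCommuting_of_starProjection_Mw {b : ℂ}
    (h : ∀ f ∈ Q.toSubmodule, Q.toSubmodule.starProjection (Mw f) = b • f) :
    Q.IsDoublyCommuting :=
  isDoublyCommuting_iff.2 fun f hf => by
    rw [h f hf, h _ (Q.adjoint_Mz_mem f hf), map_smul]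

end QuotientModule

section Sufficiency

variable {Θ : ℂ × ℂ → ℂ} {θ₁ θ₂ : ℂ → ℂ}

theorem isDoublyCommuting_quotientModule_of_Mz_mem (h : ∀ f, Mz f ∈ multiples Θ) :
    (quotientModule Θ).IsDoublyCommuting :=
  QuotientModule.isDoublyCommuting_of_adjoint_Mz_eq_zero fun f hf => ext_inner_left ℂ fun g => by
    rw [ContinuousLinearMap.adjoint_inner_right, hf _ (h g), inner_zero_right]

theorem isDoublyCommuting_quotientModule_of_Mw_sub_mem {b : ℂ}
    (h : ∀ f, Mw f - b • f ∈ multiples Θ) : (quotientModule Θ).IsDoublyCommuting :=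
  QuotientModule.isDoublyCommuting_of_starProjection_Mw (b := b) fun f hf =>
    Submodule.eq_starProjection_of_mem_orthogonal (Submodule.smul_mem _ b hf)
      (Submodule.le_orthogonal_orthogonal _ (h f))

theorem isDoublyCommuting_of_const_const (h₁ : IsInner θ₁) (h₂ : IsInner θ₂)
    (hc₁ : IsConstOnDisc θ₁) (hc₂ : IsConstOnDisc θ₂) :
    (quotientModule fun p => θ₁ (p.1 / p.2) * θ₂ p.2).IsDoublyCommuting := by
  obtain ⟨c₁, hc₁0, hc₁⟩ := h₁.exists_ne_zero_of_isConstOnDisc hc₁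
  obtain ⟨c₂, hc₂0, hc₂⟩ := h₂.exists_ne_zero_of_isConstOnDisc hc₂
  refine isDoublyCommuting_quotientModule_of_Mz_mem fun f => ⟨(c₁ * c₂)⁻¹ • Mz f, fun p hp => ?_⟩
  change Mz f p = θ₁ (p.1 / p.2) * θ₂ p.2 * ((c₁ * c₂)⁻¹ * Mz f p)
  rw [hc₁ _ (mem_ball_zero_iff.2 (norm_div_lt_one hp)), hc₂ _ (mem_ball_zero_iff.2 hp.2),
    mul_inv_cancel_left₀ (mul_ne_zero hc₁0 hc₂0)]

theorem isDoublyCommuting_of_const_blaschke (h₁ : IsInner θ₁) (hc₁ : IsConstOnDisc θ₁)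
    (hb₂ : IsBlaschkeFactor θ₂) :
    (quotientModule fun p => θ₁ (p.1 / p.2) * θ₂ p.2).IsDoublyCommuting := by
  obtain ⟨c₁, hc₁0, hc₁⟩ := h₁.exists_ne_zero_of_isConstOnDisc hc₁
  obtain ⟨b, hb, c₂, hc₂, hθ₂⟩ := hb₂
  have hc₂0 : c₂ ≠ 0 := norm_ne_zero_iff.1 (by rw [hc₂]; exact one_ne_zero)
  refine isDoublyCommuting_quotientModule_of_Mw_sub_mem (b := b) fun f =>
    ⟨(c₁ * c₂)⁻¹ • (f - conj b • Mw f), fun p hp => ?_⟩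
  have hne := one_sub_conj_mul_ne_zero (mem_ball_zero_iff.1 hb) hp.2.le
  change p.2 * f p - b * f p =
    θ₁ (p.1 / p.2) * θ₂ p.2 * ((c₁ * c₂)⁻¹ * (f p - conj b * (p.2 * f p)))
  rw [hc₁ _ (mem_ball_zero_iff.2 (norm_div_lt_one hp)), hθ₂ _ (mem_ball_zero_iff.2 hp.2)]
  rw [mul_comm] at hne
  field_simp

theorem isDoublyCommuting_of_rotation_const (h₂ : IsInner θ₂) (hr₁ : IsRotation θ₁)
    (hc₂ : IsConstOnDisc θ₂) :
    (quotientModule fun p => θ₁ (p.1 / p.2) * θ₂ p.2).IsDoublyCommuting := by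
  obtain ⟨c₁, hc₁0, hθ₁⟩ := hr₁.exists_ne_zero
  obtain ⟨c₂, hc₂0, hc₂⟩ := h₂.exists_ne_zero_of_isConstOnDisc hc₂
  refine isDoublyCommuting_quotientModule_of_Mz_mem fun f => ⟨(c₁ * c₂)⁻¹ • Mw f, fun p hp => ?_⟩
  have hp0 := snd_ne_zero hp
  change p.1 * f p = θ₁ (p.1 / p.2) * θ₂ p.2 * ((c₁ * c₂)⁻¹ * (p.2 * f p))
  rw [hθ₁ _ (mem_ball_zero_iff.2 (norm_div_lt_one hp)), hc₂ _ (mem_ball_zero_iff.2 hp.2)]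
  field_simp

theorem isDoublyCommuting_of_rotation_rotation (hr₁ : IsRotation θ₁) (hr₂ : IsRotation θ₂) :
    (quotientModule fun p => θ₁ (p.1 / p.2) * θ₂ p.2).IsDoublyCommuting := by
  obtain ⟨c₁, hc₁0, hθ₁⟩ := hr₁.exists_ne_zero
  obtain ⟨c₂, hc₂0, hθ₂⟩ := hr₂.exists_ne_zero
  refine isDoublyCommuting_quotientModule_of_Mz_mem fun f => ⟨(c₁ * c₂)⁻¹ • f, fun p hp => ?_⟩
  have hp0 := snd_ne_zero hp
  change p.1 * f p = θ₁ (p.1 / p.2) * θ₂ p.2 * ((c₁ * c₂)⁻¹ * f p)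
  rw [hθ₁ _ (mem_ball_zero_iff.2 (norm_div_lt_one hp)), hθ₂ _ (mem_ball_zero_iff.2 hp.2)]
  field_simp

end Sufficiency

section Necessity

variable {θ θ₁ θ₂ : ℂ → ℂ}

theorem mem_quotientModule_iff (h₁ : IsInner θ₁) (h₂ : IsInner θ₂) {f : HardySpace} :
    f ∈ (quotientModule fun p => θ₁ (p.1 / p.2) * θ₂ p.2).toSubmodule ↔
      (tensorMul h₁ h₂).adjoint f = 0 := by
  have hrange : multiples (fun p => θ₁ (p.1 / p.2) * θ₂ p.2) = (tensorMul h₁ h₂).range :=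
    Submodule.ext fun g => exists_congr fun k =>
      ⟨fun hg => HardySpace.ext fun p hp => (hg p hp).symm, fun hg p _ => hg ▸ rfl⟩
  change f ∈ (multiples _)ᗮ ↔ _
  rw [hrange, ContinuousLinearMap.orthogonal_range]
  rfl

theorem starProjection_quotientModule (h₁ : IsInner θ₁) (h₂ : IsInner θ₂) (f : HardySpace) :
    (quotientModule fun p => θ₁ (p.1 / p.2) * θ₂ p.2).toSubmodule.starProjection f =
      f - tensorMul h₁ h₂ ((tensorMul h₁ h₂).adjoint f) := by
  refine Submodule.eq_starProjection_of_mem_orthogonal ?_ ?_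
  · rw [mem_quotientModule_iff h₁ h₂, map_sub, adjoint_tensorMul_tensorMul, sub_self]
  · rw [sub_sub_cancel]
    exact Submodule.le_orthogonal_orthogonal _ ⟨_, fun _ _ => rfl⟩

theorem adjoint_Mz_apply (f : HardySpace) : Mz.adjoint f = Mw.adjoint (Mu.adjoint f) :=
  ext_inner_left ℂ fun g => by
    simp only [ContinuousLinearMap.adjoint_inner_right, Mz_apply_eq]

theorem adjoint_Mw_fstMul (h : IsInner θ) (f : HardySpace) :
    Mw.adjoint (fstMul h f) = fstMul h (Mw.adjoint f) := by
  rw [Mw_eq_sndMul, adjoint_sndMul_fstMul]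

theorem adjoint_Mu_sndMul (h : IsInner θ) (f : HardySpace) :
    Mu.adjoint (sndMul h f) = sndMul h (Mu.adjoint f) :=
  adjoint_fstMul_sndMul _ h f

theorem Mw_tensorMul (h₁ : IsInner θ₁) (h₂ : IsInner θ₂) (f : HardySpace) :
    Mw (tensorMul h₁ h₂ f) = tensorMul h₁ h₂ (Mw f) := by
  rw [Mw_eq_sndMul, tensorMul_comm]

theorem Mu_tensorMul (h₁ : IsInner θ₁) (h₂ : IsInner θ₂) (f : HardySpace) :
    Mu (tensorMul h₁ h₂ f) = tensorMul h₁ h₂ (Mu f) :=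
  tensorMul_comm _ _ h₁ h₂ f

theorem adjoint_tensorMul_adjoint_Mw (h₁ : IsInner θ₁) (h₂ : IsInner θ₂) (f : HardySpace) :
    (tensorMul h₁ h₂).adjoint (Mw.adjoint f) = Mw.adjoint ((tensorMul h₁ h₂).adjoint f) := by
  rw [Mw_eq_sndMul, adjoint_tensorMul_comm]

theorem adjoint_tensorMul_eq (h₁ : IsInner θ₁) (h₂ : IsInner θ₂) (f : HardySpace) :
    (tensorMul h₁ h₂).adjoint f = (sndMul h₂).adjoint ((fstMul h₁).adjoint f) :=
  ext_inner_left ℂ fun g => by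
    simp only [ContinuousLinearMap.adjoint_inner_right, tensorMul_eq_fstMul_sndMul h₁ h₂]

theorem adjoint_sndMul_Mu (h : IsInner θ) (f : HardySpace) :
    (sndMul h).adjoint (Mu f) = Mu ((sndMul h).adjoint f) :=
  adjoint_sndMul_fstMul _ h f

theorem adjoint_tensorMul_adjoint_Mu_fstMul_monomial_zero (h₁ : IsInner θ₁) (h₂ : IsInner θ₂) :
    (tensorMul h₁ h₂).adjoint (Mu.adjoint (fstMul h₁ (monomial 0))) = 0 := by
  rw [adjoint_tensorMul_comm, adjoint_tensorMul_eq h₁ h₂, adjoint_tensorMul_tensorMul,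
    adjoint_tensorMul_comm, adjoint_Mu_monomial_zero, map_zero]

theorem QuotientModule.IsDoublyCommuting.adjoint_Mu_adjoint_Mu_fstMul (h₁ : IsInner θ₁)
    (h₂ : IsInner θ₂)
    (hQ : (quotientModule fun p => θ₁ (p.1 / p.2) * θ₂ p.2).IsDoublyCommuting) :
    Mu.adjoint (Mu.adjoint (fstMul h₁ (monomial 0))) = 0 := by
  set f := Mu.adjoint (fstMul h₁ (monomial 0)) with hf
  have hf_mem : (tensorMul h₁ h₂).adjoint f = 0 :=
    adjoint_tensorMul_adjoint_Mu_fstMul_monomial_zero h₁ h₂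
  have hw : Mw.adjoint f = 0 := by
    rw [hf, ← adjoint_Mu_adjoint_Mw, adjoint_Mw_fstMul, adjoint_Mw_monomial_zero, map_zero,
      map_zero]
  have hwf_mem : (tensorMul h₁ h₂).adjoint (Mw f) = 0 := by
    rw [hf, ← adjoint_Mu_Mw, Mw_tensorMul, adjoint_tensorMul_comm, adjoint_tensorMul_eq h₁ h₂,
      adjoint_tensorMul_tensorMul, adjoint_tensorMul_comm, adjoint_Mu_Mw, adjoint_Mu_monomial_zero,
      map_zero, map_zero]
  have hcomm := QuotientModule.isDoublyCommuting_iff.1 hQ f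
    ((mem_quotientModule_iff h₁ h₂).2 hf_mem)
  rwa [starProjection_quotientModule h₁ h₂, hwf_mem, map_zero, sub_zero, adjoint_Mz_apply,
    adjoint_Mz_apply, adjoint_Mu_Mw, adjoint_Mw_Mw, ← adjoint_Mu_adjoint_Mw, hw, map_zero,
    map_zero, map_zero] at hcomm

theorem IsInner.const_or_rotation_of_fstMul_monomial_zero (h : IsInner θ) {a b : ℂ}
    (hab : fstMul h (monomial 0) = a • monomial 0 + b • Mu (monomial 0)) :
    IsConstOnDisc θ ∨ IsRotation θ := by
  refine h.const_or_rotation_of_affine (a := a) (b := b) fun z hz => ?_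
  have hmem : (z / 2, (1 / 2 : ℂ)) ∈ hartogsTriangle :=
    ⟨by norm_num; linarith [mem_ball_zero_iff.1 hz], by norm_num⟩
  have heval := congrArg (fun f : HardySpace => f (z / 2, 1 / 2)) hab
  simp only [HardySpace.add_apply, HardySpace.smul_apply, tensorMul_apply, monomial_apply _ hmem,
    Prod.fst_zero, Prod.snd_zero, pow_zero, Pi.one_apply, id] at heval
  rw [div_div_div_cancel_right₀ two_ne_zero, div_one] at heval
  norm_num at heval
  linear_combination heval / 2

theorem QuotientModule.IsDoublyCommuting.const_or_rotation_fst (h₁ : IsInner θ₁)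
    (h₂ : IsInner θ₂)
    (hQ : (quotientModule fun p => θ₁ (p.1 / p.2) * θ₂ p.2).IsDoublyCommuting) :
    IsConstOnDisc θ₁ ∨ IsRotation θ₁ := by
  set f := fstMul h₁ (monomial 0)
  have hw : Mw.adjoint f = 0 := by rw [adjoint_Mw_fstMul, adjoint_Mw_monomial_zero, map_zero]
  have hwu : Mw.adjoint (Mu.adjoint f) = 0 := by rw [← adjoint_Mu_adjoint_Mw, hw, map_zero]
  have hUf := eq_smul_monomial_zero (hQ.adjoint_Mu_adjoint_Mu_fstMul h₁ h₂) hwu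
  have hf_eq := Mu_adjoint_Mu_of_adjoint_Mw_eq_zero hw
  refine h₁.const_or_rotation_of_fstMul_monomial_zero (a := inner ℂ (monomial 0) f)
    (b := inner ℂ (monomial 0) (Mu.adjoint f)) ?_
  rw [← map_smul Mu, ← hUf, hf_eq, add_sub_cancel]

theorem inner_monomial_zero_sndMul (h : IsInner θ) :
    inner ℂ (monomial 0) (sndMul h (monomial 0)) = θ 0 := by
  rw [inner_monomial_tensorMul_monomial_zero, Prod.fst_zero, Prod.snd_zero, taylorCoeff_zero,
    taylorCoeff_zero, Pi.one_apply, one_mul]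

theorem adjoint_Mu_sndMul_monomial_zero (h : IsInner θ) :
    Mu.adjoint (sndMul h (monomial 0)) = 0 := by
  rw [adjoint_Mu_sndMul, adjoint_Mu_monomial_zero, map_zero]

theorem adjoint_sndMul_monomial_zero (h : IsInner θ) :
    (sndMul h).adjoint (monomial 0) = conj (θ 0) • monomial 0 := by
  have heq := eq_smul_monomial_zero (f := (sndMul h).adjoint (monomial 0))
    (by rw [adjoint_tensorMul_comm, adjoint_Mu_monomial_zero, map_zero])
    (by rw [← adjoint_tensorMul_adjoint_Mw, adjoint_Mw_monomial_zero, map_zero])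
  rwa [ContinuousLinearMap.adjoint_inner_right, ← inner_conj_symm,
    inner_monomial_zero_sndMul] at heq

theorem tensorMul_adjoint_tensorMul (h₁ : IsInner θ₁) (h₂ : IsInner θ₂) (f : HardySpace) :
    tensorMul h₁ h₂ ((tensorMul h₁ h₂).adjoint f) =
      sndMul h₂ (fstMul h₁ ((fstMul h₁).adjoint ((sndMul h₂).adjoint f))) := by
  rw [adjoint_tensorMul_eq, tensorMul_eq_fstMul_sndMul, tensorMul_comm, adjoint_tensorMul_comm]

theorem tensorMul_adjoint_tensorMul_monomial_zero (h₁ : IsInner θ₁) (h₂ : IsInner θ₂) :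
    tensorMul h₁ h₂ ((tensorMul h₁ h₂).adjoint (monomial 0)) =
      conj (θ₂ 0) • sndMul h₂ (fstMul h₁ ((fstMul h₁).adjoint (monomial 0))) := by
  rw [tensorMul_adjoint_tensorMul, adjoint_sndMul_monomial_zero, map_smul, map_smul, map_smul]

theorem adjoint_tensorMul_adjoint_Mw_sndMul_monomial_zero (h₁ : IsInner θ₁) (h₂ : IsInner θ₂) :
    (tensorMul h₁ h₂).adjoint (Mw.adjoint (sndMul h₂ (monomial 0))) = 0 := by
  rw [adjoint_tensorMul_adjoint_Mw, adjoint_tensorMul_eq, adjoint_tensorMul_comm,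
    adjoint_tensorMul_tensorMul, ← adjoint_tensorMul_adjoint_Mw, adjoint_Mw_monomial_zero, map_zero]

theorem tensorMul_adjoint_tensorMul_Mu_sub (h₁ : IsInner θ₁) (h₂ : IsInner θ₂)
    (hu : fstMul h₁ ((fstMul h₁).adjoint (Mu (monomial 0))) = Mu (monomial 0)) (b : ℂ) :
    tensorMul h₁ h₂ ((tensorMul h₁ h₂).adjoint
      (Mu (sndMul h₂ (monomial 0) - b • monomial 0))) =
        (1 - b * conj (θ₂ 0)) • Mu (sndMul h₂ (monomial 0)) := by
  have hsub : monomial 0 - (b * conj (θ₂ 0)) • monomial 0 =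
      (1 - b * conj (θ₂ 0)) • monomial 0 := by rw [sub_smul, one_smul]
  rw [tensorMul_adjoint_tensorMul, adjoint_sndMul_Mu, map_sub, adjoint_tensorMul_tensorMul,
    map_smul, adjoint_sndMul_monomial_zero, smul_smul, hsub, map_smul, map_smul, map_smul,
    map_smul, hu, Mu_tensorMul]

theorem QuotientModule.IsDoublyCommuting.exists_smul_adjoint_Mw_sndMul_eq (h₁ : IsInner θ₁)
    (h₂ : IsInner θ₂)
    (hQ : (quotientModule fun p => θ₁ (p.1 / p.2) * θ₂ p.2).IsDoublyCommuting)
    (hu : fstMul h₁ ((fstMul h₁).adjoint (Mu (monomial 0))) = Mu (monomial 0)) :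
    ∃ b : ℂ, (1 - θ₂ 0 * conj (θ₂ 0)) • Mw.adjoint (sndMul h₂ (monomial 0)) =
      b • (monomial 0 -
        conj (θ₂ 0) • sndMul h₂ (fstMul h₁ ((fstMul h₁).adjoint (monomial 0)))) := by
  set g := Mw.adjoint (sndMul h₂ (monomial 0)) with hg
  have hg_mem : (tensorMul h₁ h₂).adjoint g = 0 :=
    adjoint_tensorMul_adjoint_Mw_sndMul_monomial_zero h₁ h₂
  have hgu : Mu.adjoint g = 0 := by
    rw [hg, adjoint_Mu_adjoint_Mw, adjoint_Mu_sndMul_monomial_zero, map_zero]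
  have hMwg : Mw g = sndMul h₂ (monomial 0) - θ₂ 0 • monomial 0 := by
    rw [hg, Mw_adjoint_Mw_of_adjoint_Mu_eq_zero (adjoint_Mu_sndMul_monomial_zero h₂),
      inner_monomial_zero_sndMul]
  have hug_mem : (tensorMul h₁ h₂).adjoint (Mu g) = 0 := by
    rw [adjoint_tensorMul_eq, adjoint_tensorMul_comm, adjoint_sndMul_Mu,
      hg, adjoint_tensorMul_adjoint_Mw, adjoint_tensorMul_tensorMul, adjoint_Mw_monomial_zero,
      map_zero, map_zero]
  have hleft : Mz.adjoint ((quotientModule fun p => θ₁ (p.1 / p.2) *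
      θ₂ p.2).toSubmodule.starProjection (Mw (Mu g))) = (θ₂ 0 * conj (θ₂ 0)) • g := by
    rw [starProjection_quotientModule h₁ h₂, Mw_tensorMul, hMwg,
      tensorMul_adjoint_tensorMul_Mu_sub h₁ h₂ hu, adjoint_Mz_apply, map_sub, map_smul,
      adjoint_Mu_Mu, adjoint_Mu_Mu, map_sub, map_sub, map_smul, map_smul, adjoint_Mw_monomial_zero]
    module
  refine ⟨inner ℂ (monomial 0) g, ?_⟩
  have hcomm := QuotientModule.isDoublyCommuting_iff.1 hQ (Mu g)
    ((mem_quotientModule_iff h₁ h₂).2 hug_mem)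
  rw [hleft, adjoint_Mz_apply, adjoint_Mu_Mu, Mw_adjoint_Mw_of_adjoint_Mu_eq_zero hgu,
    starProjection_quotientModule h₁ h₂, map_sub, hg_mem, map_smul, zero_sub, map_neg, map_smul,
    tensorMul_adjoint_tensorMul_monomial_zero] at hcomm
  rw [sub_smul, one_smul, hcomm]
  module

theorem HardySpace.sub_apply (f g : HardySpace) (p : ℂ × ℂ) : (f - g) p = f p - g p := rfl

theorem zero_prod_mem_hartogsTriangle {w : ℂ} (hw : w ∈ Metric.ball (0 : ℂ) 1) (hw0 : w ≠ 0) :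
    ((0, w) : ℂ × ℂ) ∈ hartogsTriangle :=
  ⟨by simpa using hw0, mem_ball_zero_iff.1 hw⟩

theorem QuotientModule.IsDoublyCommuting.exists_mul_sub_eq (h₁ : IsInner θ₁) (h₂ : IsInner θ₂)
    (hQ : (quotientModule fun p => θ₁ (p.1 / p.2) * θ₂ p.2).IsDoublyCommuting)
    (hu : fstMul h₁ ((fstMul h₁).adjoint (Mu (monomial 0))) = Mu (monomial 0)) {k : ℂ}
    (hk : fstMul h₁ ((fstMul h₁).adjoint (monomial 0)) = k • monomial 0) :
    ∃ b : ℂ, ∀ w ∈ Metric.ball (0 : ℂ) 1,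
      (1 - θ₂ 0 * conj (θ₂ 0)) * (θ₂ w - θ₂ 0) = b * w * (1 - conj (θ₂ 0) * k * θ₂ w) := by
  obtain ⟨b, hb⟩ := hQ.exists_smul_adjoint_Mw_sndMul_eq h₁ h₂ hu
  have hb_mul := congrArg Mw hb
  rw [map_smul Mw, map_smul Mw, hk, map_smul (sndMul h₂),
    Mw_adjoint_Mw_of_adjoint_Mu_eq_zero (adjoint_Mu_sndMul_monomial_zero h₂),
    inner_monomial_zero_sndMul] at hb_mul
  refine ⟨b, fun w hw => ?_⟩
  obtain rfl | hw0 := eq_or_ne w 0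
  · simp
  have hmem := zero_prod_mem_hartogsTriangle hw hw0
  have heval := congrArg (fun f : HardySpace => f (0, w)) hb_mul
  simp only [HardySpace.sub_apply, HardySpace.smul_apply, tensorMul_apply, Mw_apply,
    monomial_apply _ hmem, Prod.fst_zero, Prod.snd_zero, pow_zero, Pi.one_apply] at heval
  field_simp at heval
  linear_combination heval

theorem fstMul_adjoint_fstMul_of_const (h : IsInner θ) (hc : IsConstOnDisc θ) (f : HardySpace) :
    fstMul h ((fstMul h).adjoint f) = f := by
  obtain ⟨c, hc0, hc⟩ := h.exists_ne_zero_of_isConstOnDisc hc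
  have hf : fstMul h (c⁻¹ • f) = f := HardySpace.ext fun p hp => by
    rw [tensorMul_apply, HardySpace.smul_apply, Pi.one_apply, mul_one,
      hc _ (mem_ball_zero_iff.2 (norm_div_lt_one hp)), mul_inv_cancel_left₀ hc0]
  rw [← hf, adjoint_tensorMul_tensorMul]

theorem IsRotation.exists_fstMul_eq (h : IsInner θ) (hr : IsRotation θ) :
    ∃ c : ℂ, c ≠ 0 ∧ ∀ f, fstMul h f = c • Mu f := by
  obtain ⟨c, hc0, hc⟩ := hr.exists_ne_zero
  refine ⟨c, hc0, fun f => HardySpace.ext fun p hp => ?_⟩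
  rw [HardySpace.smul_apply, tensorMul_apply, tensorMul_apply,
    hc _ (mem_ball_zero_iff.2 (norm_div_lt_one hp)), mul_assoc, mul_assoc, mul_assoc]
  rfl

theorem fstMul_adjoint_fstMul_Mu_of_rotation (h : IsInner θ) (hr : IsRotation θ)
    (f : HardySpace) : fstMul h ((fstMul h).adjoint (Mu f)) = Mu f := by
  obtain ⟨c, hc0, hc⟩ := hr.exists_fstMul_eq h
  have hf : fstMul h (c⁻¹ • f) = Mu f := by rw [hc, map_smul, smul_inv_smul₀ hc0]
  rw [← hf, adjoint_tensorMul_tensorMul]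

theorem adjoint_fstMul_monomial_zero_of_rotation (h : IsInner θ) (hr : IsRotation θ) :
    (fstMul h).adjoint (monomial 0) = 0 := by
  obtain ⟨c, -, hc⟩ := hr.exists_fstMul_eq h
  refine ext_inner_left ℂ fun g => ?_
  rw [ContinuousLinearMap.adjoint_inner_right, hc, inner_smul_left,
    ← ContinuousLinearMap.adjoint_inner_right, adjoint_Mu_monomial_zero, inner_zero_right,
    mul_zero]

theorem QuotientModule.IsDoublyCommuting.const_or_blaschke_snd (h₁ : IsInner θ₁)
    (h₂ : IsInner θ₂)
    (hQ : (quotientModule fun p => θ₁ (p.1 / p.2) * θ₂ p.2).IsDoublyCommuting)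
    (hc : IsConstOnDisc θ₁) : IsConstOnDisc θ₂ ∨ IsBlaschkeFactor θ₂ := by
  obtain h0 | h0 := (h₂.norm_le_one 0 (Metric.mem_ball_self one_pos)).eq_or_lt
  · exact .inl (h₂.isConstOnDisc_of_norm_apply_zero h0)
  obtain ⟨b, hb⟩ := hQ.exists_mul_sub_eq h₁ h₂ (fstMul_adjoint_fstMul_of_const h₁ hc _) (k := 1)
    (by rw [fstMul_adjoint_fstMul_of_const h₁ hc, one_smul])
  refine .inr <| h₂.isBlaschkeFactor_of_sub_eq h0 (l := (1 - θ₂ 0 * conj (θ₂ 0))⁻¹ * b)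
    fun w hw => ?_
  rw [mul_assoc, mul_assoc, eq_inv_mul_iff_mul_eq₀ (one_sub_mul_conj_ne_zero h0), hb w hw,
    mul_one, mul_assoc]

theorem QuotientModule.IsDoublyCommuting.const_or_rotation_snd (h₁ : IsInner θ₁)
    (h₂ : IsInner θ₂)
    (hQ : (quotientModule fun p => θ₁ (p.1 / p.2) * θ₂ p.2).IsDoublyCommuting)
    (hr : IsRotation θ₁) : IsConstOnDisc θ₂ ∨ IsRotation θ₂ := by
  obtain h0 | h0 := (h₂.norm_le_one 0 (Metric.mem_ball_self one_pos)).eq_or_lt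
  · exact .inl (h₂.isConstOnDisc_of_norm_apply_zero h0)
  obtain ⟨b, hb⟩ := hQ.exists_mul_sub_eq h₁ h₂ (fstMul_adjoint_fstMul_Mu_of_rotation h₁ hr _)
    (k := 0)
    (by rw [adjoint_fstMul_monomial_zero_of_rotation h₁ hr, map_zero (fstMul h₁), zero_smul])
  refine h₂.const_or_rotation_of_affine (a := θ₂ 0) (b := (1 - θ₂ 0 * conj (θ₂ 0))⁻¹ * b)
    fun w hw => ?_
  rw [← sub_eq_iff_eq_add', mul_assoc,
    eq_inv_mul_iff_mul_eq₀ (one_sub_mul_conj_ne_zero h0), hb w hw, mul_zero, zero_mul, sub_zero,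
    mul_one]

end Necessity

end Hartogs

theorem theorem1p2 (θ₁ θ₂ : ℂ → ℂ) (h₁ : Hartogs.IsInner θ₁) (h₂ : Hartogs.IsInner θ₂) :
    (Hartogs.quotientModule fun p => θ₁ (p.1 / p.2) * θ₂ p.2).IsDoublyCommuting ↔
      ((∃ c₁ : ℂ, ∀ z ∈ Metric.ball (0 : ℂ) 1, θ₁ z = c₁) ∧
        (∃ c₂ : ℂ, ∀ w ∈ Metric.ball (0 : ℂ) 1, θ₂ w = c₂)) ∨
      ((∃ c₁ : ℂ, ∀ z ∈ Metric.ball (0 : ℂ) 1, θ₁ z = c₁) ∧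
        (∃ b ∈ Metric.ball (0 : ℂ) 1, ∃ c : ℂ, ‖c‖ = 1 ∧
          ∀ w ∈ Metric.ball (0 : ℂ) 1, θ₂ w = c * ((w - b) / (1 - starRingEnd ℂ b * w)))) ∨
      ((∃ c₂ : ℂ, ∀ w ∈ Metric.ball (0 : ℂ) 1, θ₂ w = c₂) ∧
        (∃ c₁ : ℂ, ‖c₁‖ = 1 ∧ ∀ z ∈ Metric.ball (0 : ℂ) 1, θ₁ z = c₁ * z)) ∨
      ((∃ c₁ : ℂ, ‖c₁‖ = 1 ∧ ∀ z ∈ Metric.ball (0 : ℂ) 1, θ₁ z = c₁ * z) ∧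
        (∃ c₂ : ℂ, ‖c₂‖ = 1 ∧ ∀ w ∈ Metric.ball (0 : ℂ) 1, θ₂ w = c₂ * w)) := by
  constructor
  · intro hQ
    rcases hQ.const_or_rotation_fst h₁ h₂ with hc₁ | hr₁
    · rcases hQ.const_or_blaschke_snd h₁ h₂ hc₁ with hc₂ | hb₂
      exacts [.inl ⟨hc₁, hc₂⟩, .inr (.inl ⟨hc₁, hb₂⟩)]
    · rcases hQ.const_or_rotation_snd h₁ h₂ hr₁ with hc₂ | hr₂
      exacts [.inr (.inr (.inl ⟨hc₂, hr₁⟩)), .inr (.inr (.inr ⟨hr₁, hr₂⟩))]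
  · rintro (⟨hc₁, hc₂⟩ | ⟨hc₁, hb₂⟩ | ⟨hc₂, hr₁⟩ | ⟨hr₁, hr₂⟩)
    · exact Hartogs.isDoublyCommuting_of_const_const h₁ h₂ hc₁ hc₂
    · exact Hartogs.isDoublyCommuting_of_const_blaschke h₁ hc₁ hb₂
    · exact Hartogs.isDoublyCommuting_of_rotation_const h₂ hr₁ hc₂
    · exact Hartogs.isDoublyCommuting_of_rotation_rotation hr₁ hr₂
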